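/- Let $d\ge 0$, let $\Lambda\subseteq\mathbb R^d$ be a $d$-dimensional lattice, let $K$ be a locally finite cell complex in $\mathbb R^d$ that is $\Lambda$-periodic ($\sigma+u\in K$ for all cells $\sigma\in K$ and $u\in\Lambda$), and let $F\colon K\to\mathbb R$ be a $\Lambda$-periodic filter, i.e. $F(\sigma)\le F(\tau)$ whenever $\sigma$ is a face of $\tau$, and $F(\sigma+u)=F(\sigma)$ for all $u\in\Lambda$. Let $\Lambda',\Lambda''\subseteq\Lambda$ be two $d$-dimensional sublattices. Then the periodic $0$-th barcodes of $F$ with respect to $\Lambda'$ and $\Lambda''$, which are defined below, exist, do not depend on how ties in the elder rule are broken, and coincide: $$\mathcal B(F,\Lambda')=\mathcal B(F,\Lambda'').$$ Definitions, for a $d$-dimensional lattice $\Lambda$ with respect to which $K$ and $F$ are periodic. *Periodic merge tree.* For $t\in\mathbb R$ let $(K/\Lambda)_t\subseteq\mathbb R^d/\Lambda$ be the image of the union of all cells $\sigma$ with $F(\sigma)\le t$. The periodic merge tree $M$ has as its points all pairs $A=(C,t)$ where $C$ is a connected component of $(K/\Lambda)_t$; the height of $A$ is $h(A)=t$. We write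 $A\le B$ ("$B$ covers $A$") if $h(A)\le h(B)$ and the component of $A$ is contained in that of $B$. Let $\phi\colon\mathbb R^d\to\mathbb R^d/\Lambda$ be the projection. The shadows of $C$ are the connected components of $\phi^{-1}(C)$, and the periodicity lattice $\Lambda_C$ is the group of all $u\in\Lambda$ with $c+u=c$ for all shadows $c$ of $C$. With $p=\dim\Lambda_C$, the point $A$ is decorated with the shadow monomial $$\frac{\mathrm{vol}_p(\Lambda_C)}{\mathrm{vol}_d(\Lambda)}\,\nu_{d-p}R^{d-p},$$ where $\mathrm{vol}$ is the volume of a unit cell and $\nu_q$ is the volume of the unit ball in $\mathbb R^q$. *Beams.* An elder rule assigns to each $A\in M$ a point $o(A)\le A$ of minimum height among all points $\le A$, in such a way that $o(B)=o(A)$ whenever $o(A)\le B\le A$ (ties are broken arbitrarily). The beam with left endpoint $G$ is $\{A\in M: o(A)=G\}$. *Epochs and bars.* An epoch is a maximal interval of a beam on which the shadow monomial is constant. An epoch with monomial $s\,\nu_qR^q$ that lies on the beam with left endpoint $G$, starts at height $a$, and ends at height $c\in(-\infty,\infty]$ contributes to the $q$-ary barcode the bar $[h(G),c)$ with multiplicity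 $s$ and the bar $[h(G),a)$ with multiplicity $-s$, the latter being skipped if $a=h(G)$. There are only finitely many epochs. The periodic $0$-th barcode $\mathcal B(F,\Lambda)$ is the ensemble, for $q=0,1,\dots,d$, of the functions $\mathbb R\times(-\infty,\infty]\to\mathbb R$ that map $(b,x)$ to the sum of the multiplicities of all bars $[b,x)$ in the $q$-ary barcode. -/

import Mathlib

open scoped Pointwise Polynomial

noncomputable section

/-- Euclidean space of dimension `d`. -/
abbrev Euc (d : ℕ) : Type := EuclideanSpace ℝ (Fin d)

/-! ### Cell complexes and filters -/

/-- `σ` is homeomorphic to the closed unit ball of dimension `p`, and `bd` is the subset of `σ`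
that corresponds to the unit sphere (the boundary of the cell). For `p = 0` this says that `σ` is
a single point and that `bd` is empty. -/
def IsClosedCell {d : ℕ} (p : ℕ) (σ bd : Set (Euc d)) : Prop :=
  ∃ h : Metric.closedBall (0 : Euc p) 1 ≃ₜ σ,
    bd = {x | ∃ y : Metric.closedBall (0 : Euc p) 1, ‖(y : Euc p)‖ = 1 ∧ (h y : Euc d) = x}

/-- A locally finite cell complex in `ℝ^d` (with possibly infinitely many cells). The vertices are
the cells of dimension `0` and the edges are the cells of dimension `1`. -/
structure CellComplex (d : ℕ) where
  /-- the cells, each a closed subset of `ℝ^d` -/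
  cells : Set (Set (Euc d))
  /-- the dimension of a cell -/
  dim : cells → ℕ
  /-- the boundary of a cell -/
  boundary : cells → Set (Euc d)
  dim_le : ∀ σ, dim σ ≤ d
  isClosedCell : ∀ σ : cells, IsClosedCell (dim σ) (σ : Set (Euc d)) (boundary σ)
  /-- The boundary of a cell is a union of lower-dimensional cells of the complex. -/
  boundary_eq : ∀ τ : cells, boundary τ =
    ⋃ σ ∈ {σ : cells | dim σ < dim τ ∧ (σ : Set (Euc d)) ⊆ boundary τ}, (σ : Set (Euc d))
  /-- The intersection of two cells is a (possibly empty) union of cells each of which is, for both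
  of the two cells, contained in the boundary or equal to the cell itself. -/
  inter_eq : ∀ σ τ : cells, (σ : Set (Euc d)) ∩ τ =
    ⋃ ρ ∈ {ρ : cells | (ρ = σ ∨ (ρ : Set (Euc d)) ⊆ boundary σ) ∧
      (ρ = τ ∨ (ρ : Set (Euc d)) ⊆ boundary τ)}, (ρ : Set (Euc d))
  locallyFinite : LocallyFinite (fun σ : cells => (σ : Set (Euc d)))

namespace CellComplex

variable {d : ℕ} (K : CellComplex d)

/-- `σ` is a face of `τ`: a lower-dimensional cell contained in the boundary of `τ`. -/
def IsFace (σ τ : K.cells) : Prop :=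
  K.dim σ < K.dim τ ∧ (σ : Set (Euc d)) ⊆ K.boundary τ

/-- A filter of `K`: a real function on the cells that is monotone along faces. -/
def IsFilter (f : K.cells → ℝ) : Prop :=
  ∀ σ τ : K.cells, K.IsFace σ τ → f σ ≤ f τ

/-- `K` is periodic with respect to `Λ`: translates of cells by lattice vectors are cells. -/
def IsPeriodic (Λ : Submodule ℤ (Euc d)) : Prop :=
  ∀ σ ∈ K.cells, ∀ u ∈ Λ, u +ᵥ σ ∈ K.cells

/-- `f` takes the same value on any two cells that are translates by a lattice vector. -/
def IsPeriodicFun (f : K.cells → ℝ) (Λ : Submodule ℤ (Euc d)) : Prop :=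
  ∀ σ τ : K.cells, ∀ u ∈ Λ, (τ : Set (Euc d)) = u +ᵥ (σ : Set (Euc d)) → f τ = f σ

end CellComplex

/-! ### Merge trees -/

section MergeTree

variable {T : Type} [TopologicalSpace T]

/-- The sublevel space of a family `X t` of subspaces of `T`: all pairs `(x, t)` with `x ∈ X t`. -/
def SublevelSpace (X : ℝ → Set T) : Type := {p : T × ℝ // p.1 ∈ X p.2}

instance (X : ℝ → Set T) : TopologicalSpace (SublevelSpace X) :=
  inferInstanceAs (TopologicalSpace {p : T × ℝ // p.1 ∈ X p.2})

/-- The connected component of `X t` that contains `x`, where `p = (x, t)`. -/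
def SublevelSpace.comp {X : ℝ → Set T} (p : SublevelSpace X) : Set T :=
  connectedComponentIn (X p.1.2) p.1.1

/-- `(x, s) ∼ (y, t)` if `s = t` and `x`, `y` lie in the same component of `X s = X t`. -/
def sublevelSetoid (X : ℝ → Set T) : Setoid (SublevelSpace X) :=
  Setoid.ker (fun p : SublevelSpace X => (p.1.2, p.comp))

/-- The merge tree: the quotient of the sublevel space, with the quotient topology. Its points
are the connected components of the sets `X t`, for all heights `t`. -/
def MergeTree (X : ℝ → Set T) : Type := Quotient (sublevelSetoid X)

namespace MergeTree

variable {X : ℝ → Set T}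

instance : TopologicalSpace (MergeTree X) :=
  inferInstanceAs (TopologicalSpace (Quotient (sublevelSetoid X)))

/-- The height function. -/
def height (A : MergeTree X) : ℝ :=
  Quotient.lift (fun p : SublevelSpace X => p.1.2) (fun _ _ h => congrArg Prod.fst h) A

/-- A point of the merge tree as a connected component of the sublevel set at its height. -/
def comp (A : MergeTree X) : Set T :=
  Quotient.lift (fun p : SublevelSpace X => p.comp) (fun _ _ h => congrArg Prod.snd h) A

/-- `A ≤ B` means that `B` covers `A`. -/
instance : PartialOrder (MergeTree X) where
  le A B := A.height ≤ B.height ∧ A.comp ⊆ B.comp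
  le_refl A := ⟨le_refl _, subset_rfl⟩
  le_trans A B C h₁ h₂ := ⟨h₁.1.trans h₂.1, h₁.2.trans h₂.2⟩
  le_antisymm A B h₁ h₂ := by
    induction A using Quotient.inductionOn with
    | h p =>
      induction B using Quotient.inductionOn with
      | h q =>
        exact Quotient.sound (Prod.ext (le_antisymm h₁.1 h₂.1) (h₁.2.antisymm h₂.2))

end MergeTree

end MergeTree

/-! ### Lattices and volumes -/

/-- The dimension of a lattice `L` in `ℝ^d`, not necessarily of full rank: the dimension of its
real span. -/
def latticeDim {d : ℕ} (L : Submodule ℤ (Euc d)) : ℕ :=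
  Module.finrank ℝ (Submodule.span ℝ (L : Set (Euc d)))

/-- The `p`-dimensional volume of a unit cell of a `p`-dimensional lattice `L` in `ℝ^d`, measured
inside the real span of `L`. -/
def latticeVolume {d : ℕ} (L : Submodule ℤ (Euc d)) : ℝ :=
  ZLattice.covolume
    (ZLattice.comap ℝ L (Submodule.span ℝ (L : Set (Euc d))).subtype)
    (MeasureTheory.volume : MeasureTheory.Measure (Submodule.span ℝ (L : Set (Euc d))))

/-- The volume of the unit ball in `ℝ^q`. -/
def unitBallVolume (q : ℕ) : ℝ :=
  (MeasureTheory.volume (Metric.ball (0 : Euc q) 1)).toReal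

/-! ### The periodic merge tree -/

section Periodic

variable {d : ℕ}

/-- `c` is a shadow of the subset `C` of the torus: a connected component of the preimage of `C`
under the projection from `ℝ^d`. -/
def IsShadow (Λ : Submodule ℤ (Euc d)) (C : Set (Euc d ⧸ Λ)) (c : Set (Euc d)) : Prop :=
  ∃ x ∈ Λ.mkQ ⁻¹' C, c = connectedComponentIn (Λ.mkQ ⁻¹' C) x

/-- The periodicity lattice of `C`: all lattice vectors that keep the shadows of `C` invariant. -/
def periodicityLattice (Λ : Submodule ℤ (Euc d)) (C : Set (Euc d ⧸ Λ)) : Submodule ℤ (Euc d) :=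
  AddSubgroup.toIntSubmodule
    { carrier := {u | u ∈ Λ ∧ ∀ c, IsShadow Λ C c → u +ᵥ c = c}
      zero_mem' := ⟨Λ.zero_mem, fun c _ => zero_vadd _ c⟩
      add_mem' := fun {u v} hu hv =>
        ⟨Λ.add_mem hu.1 hv.1, fun c hc => by rw [add_vadd, hv.2 c hc, hu.2 c hc]⟩
      neg_mem' := fun {u} hu =>
        ⟨Λ.neg_mem hu.1, fun c hc => by rw [neg_vadd_eq_iff, hu.2 c hc]⟩ }

/-- The shadow monomial `(vol Λ_C / vol Λ) * ν_(d-p) * R ^ (d-p)`, a monomial in the variable `R`,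
where `Λ_C` is the periodicity lattice of `C` and `p` is its dimension. -/
def shadowMonomial (Λ : Submodule ℤ (Euc d)) (C : Set (Euc d ⧸ Λ)) : ℝ[X] :=
  Polynomial.monomial (d - latticeDim (periodicityLattice Λ C))
    (latticeVolume (periodicityLattice Λ C) / latticeVolume Λ *
      unitBallVolume (d - latticeDim (periodicityLattice Λ C)))

/-- The sublevel set at `t` of the quotient filter on the quotient complex, as a subset of the
torus: the cells of the quotient complex are the projections of the cells of `K`, and the quotient
filter gives the projection of a cell `σ` the value `f σ`. -/
def quotientSublevel (K : CellComplex d) (f : K.cells → ℝ) (Λ : Submodule ℤ (Euc d)) (t : ℝ) :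
    Set (Euc d ⧸ Λ) :=
  ⋃ σ ∈ {σ : K.cells | f σ ≤ t}, Λ.mkQ '' (σ : Set (Euc d))

/-- The periodic merge tree of `f` with respect to `Λ`: the merge tree of the quotient filter. It
comes with its height function `MergeTree.height` and the function `frequency` below. -/
abbrev PeriodicMergeTree (K : CellComplex d) (f : K.cells → ℝ) (Λ : Submodule ℤ (Euc d)) : Type :=
  MergeTree (quotientSublevel K f Λ)

/-- The frequency function maps every point of the periodic merge tree to its shadow monomial. -/
def frequency (K : CellComplex d) (f : K.cells → ℝ) (Λ : Submodule ℤ (Euc d))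
    (A : PeriodicMergeTree K f Λ) : ℝ[X] :=
  shadowMonomial Λ A.comp

end Periodic

/-! ### Beams, epochs, and the barcode -/

section Barcode

/-- A decomposition of a tree into beams by the elder rule, with ties broken in an arbitrary way.
The beams correspond to their left endpoints, and `oldest A` is the left endpoint of the beam that
contains `A`. -/
structure ElderRule {M : Type} [PartialOrder M] (height : M → ℝ) where
  /-- the left endpoint of the beam through a point -/
  oldest : M → M
  oldest_le : ∀ A, oldest A ≤ A
  /-- The left endpoint has minimum height in the subtree of `A`. -/
  height_oldest_le : ∀ A B, B ≤ A → height (oldest A) ≤ height B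
  /-- Beams are not interrupted: every point between `oldest A` and `A` is on the beam of `A`. -/
  oldest_eq : ∀ A B, oldest A ≤ B → B ≤ A → oldest B = oldest A

variable {M : Type} [PartialOrder M] {height : M → ℝ}

/-- An epoch of the tree with frequency function `freq`: a maximal interval of points on a common
beam on which the frequency function is constant. -/
structure Epoch (e : ElderRule height) (freq : M → ℝ[X]) where
  /-- the left endpoint of the beam that contains the epoch -/
  leaf : M
  /-- the monomial that decorates the epoch -/
  label : ℝ[X]
  /-- the points of the epoch -/
  points : Set M
  maximal : Maximal (fun S : Set M => S.Nonempty ∧ S.OrdConnected ∧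
    ∀ A ∈ S, e.oldest A = leaf ∧ freq A = label) points

namespace Epoch

variable {e : ElderRule height} {freq : M → ℝ[X]} (E : Epoch e freq)

/-- The height at which the beam of the epoch is born. -/
def birth : ℝ := height E.leaf

/-- The height at which the epoch starts. -/
def start : ℝ := sInf (height '' E.points)

/-- The height at which the epoch ends, or `⊤` if it does not end. -/
def finish : WithTop ℝ := sSup ((fun A => (height A : WithTop ℝ)) '' E.points)

/-- The exponent of the monomial that decorates the epoch; it determines the era. -/
def exponent : ℕ := E.label.natDegree

/-- The real number `s` such that `s * ν_q * R ^ q` is the monomial that decorates the epoch. -/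
def multiplicity : ℝ := E.label.leadingCoeff / unitBallVolume E.exponent

end Epoch

open Classical in
/-- The barcode as an ensemble of multiplicity functions, one for each era `q = 0, 1, ..., d`. Every
epoch in era `q`, with birth `b₀`, start `a`, end `c`, and monomial `s * ν_q * R ^ q`, contributes
the bar `[b₀, c)` with multiplicity `s` and the bar `[b₀, a)` with multiplicity `-s`, where the
second bar is skipped if it is empty. The value at `(b, x)` is the sum of the multiplicities of all
bars `[b, x)` in the era. -/
def barcode (d : ℕ) (e : ElderRule height) (freq : M → ℝ[X]) :
    Fin (d + 1) → ℝ × WithTop ℝ → ℝ := fun q z =>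
  ∑ᶠ E : Epoch e freq,
    if E.exponent = (q : ℕ) then
      (if z = (E.birth, E.finish) then E.multiplicity else 0) +
        (if E.birth < E.start ∧ z = (E.birth, (E.start : WithTop ℝ)) then -E.multiplicity else 0)
    else 0

/-- The ways to apply the elder rule to the periodic merge tree of `f` with respect to `Λ`. -/
abbrev PeriodicElderRule {d : ℕ} (K : CellComplex d) (f : K.cells → ℝ) (Λ : Submodule ℤ (Euc d)) :
    Type :=
  ElderRule (MergeTree.height (X := quotientSublevel K f Λ))

/-- The periodic `0`-th barcode of `f` with respect to `Λ`, constructed with the elder rule `e`. -/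
def periodicBarcode {d : ℕ} (K : CellComplex d) (f : K.cells → ℝ) (Λ : Submodule ℤ (Euc d))
    (e : PeriodicElderRule K f Λ) : Fin (d + 1) → ℝ × WithTop ℝ → ℝ :=
  barcode d e (frequency K f Λ)

end Barcode

end

/-! ### Volumes of lattices -/

section Lattice

variable {d : ℕ}

/-! Bars can be read off from the mass alive at each height. For exponent q, birth b and height t,
`eraDensity` sums the multiplicities of the points at height t that have exponent q and whose
subtree has minimum height b. An elder rule enters only through the height of the oldest point,
which is that minimum (`ElderRule.height_oldest`), so the way ties are broken leaves no trace. There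
are finitely many epochs, and their heights form half-open intervals [a, c) with a critical and c
critical or infinite. Hence, for x > b, the multiplicity of [b, x) is the drop of the density across
x (`barcode_coe`), and that of [b, ∞) is the density above all critical values (`barcode_top`). So
the densities determine the barcode (`barcode_eq_of_eraDensity_eq`).

It remains to see that the density does not change on passing from Λ to a full-rank sublattice Λ'
(`eraDensity_eq_of_le`). Shadows are components of the sublevel set in ℝ^d, a set that does not
involve the lattice. A component over Λ with periodicity lattice S splits into [Λ : Λ' + S]
components over Λ' (`card_fiberOver`), each with periodicity lattice Λ' ∩ S
(`periodicityLattice_eq_inf`) and the same birth (`birth_eq`). Since [S : Λ' ∩ S] [Λ : Λ' + S] = [Λ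
: Λ'], their densities vol(Λ' ∩ S) / vol(Λ') add up to vol(S) / vol(Λ)
(`relIndex_sup_mul_latticeVolume_div`). Both sublattices are thus compared with Λ. -/

theorem unitBallVolume_pos (q : ℕ) : 0 < unitBallVolume q :=
  ENNReal.toReal_pos (Metric.measure_ball_pos _ _ one_pos).ne' MeasureTheory.measure_ball_lt_top.ne

theorem Submodule.discreteTopology_of_le {L₁ L₂ : Submodule ℤ (Euc d)} (h : L₁ ≤ L₂)
    [DiscreteTopology L₂] : DiscreteTopology L₁ :=
  DiscreteTopology.of_subset (s := (L₂ : Set (Euc d))) ‹_› h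

theorem discreteTopology_comap_subtype (L : Submodule ℤ (Euc d)) [DiscreteTopology L]
    (V : Submodule ℝ (Euc d)) : DiscreteTopology (ZLattice.comap ℝ L V.subtype) :=
  ZLattice.comap_discreteTopology ℝ L continuous_subtype_val V.injective_subtype

theorem isZLattice_comap_subtype (L : Submodule ℤ (Euc d)) (V : Submodule ℝ (Euc d))
    [DiscreteTopology (ZLattice.comap ℝ L V.subtype)] (hV : Submodule.span ℝ (L : Set (Euc d)) = V) :
    IsZLattice ℝ (ZLattice.comap ℝ L V.subtype) := by
  subst hV
  exact ⟨Submodule.span_span_coe_preimage⟩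

theorem latticeVolume_eq (L : Submodule ℤ (Euc d)) (V : Submodule ℝ (Euc d))
    (hV : Submodule.span ℝ (L : Set (Euc d)) = V) :
    latticeVolume L = ZLattice.covolume (ZLattice.comap ℝ L V.subtype)
      (MeasureTheory.volume : MeasureTheory.Measure V) := by
  subst hV
  rfl

theorem latticeVolume_pos (L : Submodule ℤ (Euc d)) [DiscreteTopology L] :
    0 < latticeVolume L := by
  have := discreteTopology_comap_subtype L (Submodule.span ℝ (L : Set (Euc d)))
  have := isZLattice_comap_subtype L _ rfl
  exact ZLattice.covolume_pos _ _

/-- Inside the common real span both are full-rank lattices, where the quotient of covolumes is the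
index. -/
theorem latticeVolume_eq_relIndex_mul {L₁ L₂ : Submodule ℤ (Euc d)} [DiscreteTopology L₂]
    (h : L₁ ≤ L₂)
    (hs : Submodule.span ℝ (L₁ : Set (Euc d)) = Submodule.span ℝ (L₂ : Set (Euc d))) :
    latticeVolume L₁ = L₁.toAddSubgroup.relIndex L₂.toAddSubgroup * latticeVolume L₂ := by
  have := Submodule.discreteTopology_of_le h
  set V := Submodule.span ℝ (L₂ : Set (Euc d)) with hV
  have := discreteTopology_comap_subtype L₁ V
  have := isZLattice_comap_subtype L₁ V hs
  have := discreteTopology_comap_subtype L₂ V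
  have := isZLattice_comap_subtype L₂ V rfl
  rw [← div_eq_iff (latticeVolume_pos L₂).ne', latticeVolume_eq L₁ V hs,
    latticeVolume_eq L₂ V rfl, ZLattice.covolume_div_covolume_eq_relIndex'
      (ZLattice.comap ℝ L₁ V.subtype) (ZLattice.comap ℝ L₂ V.subtype) fun _ hx => h hx, ZLattice.comap_toAddSubgroup, ZLattice.comap_toAddSubgroup,
    AddSubgroup.relIndex_comap, AddSubgroup.map_comap_eq_self]
  intro x hx
  exact ⟨⟨x, Submodule.subset_span hx⟩, rfl⟩

/-- Some positive multiple of every vector of `L₂` lies in `L₁`, and over ℝ one can divide by it. -/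
theorem span_eq_of_relIndex_ne_zero {L₁ L₂ : Submodule ℤ (Euc d)} (h : L₁ ≤ L₂)
    (hi : L₁.toAddSubgroup.relIndex L₂.toAddSubgroup ≠ 0) :
    Submodule.span ℝ (L₁ : Set (Euc d)) = Submodule.span ℝ (L₂ : Set (Euc d)) := by
  refine le_antisymm (Submodule.span_mono h) (Submodule.span_le.2 fun x hx => ?_)
  obtain ⟨n, hn, -, hmem⟩ := AddSubgroup.exists_nsmul_mem_of_relIndex_ne_zero hi
    (show x ∈ L₂.toAddSubgroup from hx)
  have h1 : (n : ℝ) • x ∈ Submodule.span ℝ (L₁ : Set (Euc d)) := by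
    rw [Nat.cast_smul_eq_nsmul]
    exact Submodule.subset_span hmem.1
  have hn' : (n : ℝ) ≠ 0 := by exact_mod_cast hn.ne'
  simpa [smul_smul, hn'] using Submodule.smul_mem _ (n : ℝ)⁻¹ h1

theorem Submodule.toAddSubgroup_inf (p q : Submodule ℤ (Euc d)) :
    (p ⊓ q).toAddSubgroup = p.toAddSubgroup ⊓ q.toAddSubgroup := rfl

/-- The value 0 encodes infinite index; by the covolume formula it would force `L₁` to have volume
0. -/
theorem relIndex_ne_zero_of_isZLattice {L₁ L₂ : Submodule ℤ (Euc d)} [DiscreteTopology L₁]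
    [IsZLattice ℝ L₁] [DiscreteTopology L₂] [IsZLattice ℝ L₂] (h : L₁ ≤ L₂) :
    L₁.toAddSubgroup.relIndex L₂.toAddSubgroup ≠ 0 := by
  have h1 := latticeVolume_eq_relIndex_mul h
    ((IsZLattice.span_top (K := ℝ) (L := L₁)).trans (IsZLattice.span_top (K := ℝ) (L := L₂)).symm)
  intro h0
  rw [h0] at h1
  exact (latticeVolume_pos L₁).ne' (by simpa using h1)

/-- The number of translates, times the density of each, is preserved when passing to a
sublattice of finite index. -/
theorem relIndex_sup_mul_latticeVolume_div {L' L S : Submodule ℤ (Euc d)} [DiscreteTopology L']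
    [IsZLattice ℝ L'] [DiscreteTopology L] [IsZLattice ℝ L] (h : L' ≤ L) (hS : S ≤ L) :
    ((L' ⊔ S).toAddSubgroup.relIndex L.toAddSubgroup : ℝ) *
      (latticeVolume (L' ⊓ S) / latticeVolume L') = latticeVolume S / latticeVolume L := by
  have hdS := Submodule.discreteTopology_of_le hS
  have hi := relIndex_ne_zero_of_isZLattice h
  have e1 : (L' ⊓ S).toAddSubgroup.relIndex S.toAddSubgroup =
      L'.toAddSubgroup.relIndex S.toAddSubgroup := by
    rw [Submodule.toAddSubgroup_inf, AddSubgroup.inf_relIndex_right]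
  have hi' : L'.toAddSubgroup.relIndex S.toAddSubgroup ≠ 0 :=
    mt (AddSubgroup.relIndex_eq_zero_of_le_right hS) hi
  have h1 := latticeVolume_eq_relIndex_mul (inf_le_right : L' ⊓ S ≤ S)
    (span_eq_of_relIndex_ne_zero inf_le_right (by rwa [e1]))
  have h2 := latticeVolume_eq_relIndex_mul h
    (span_eq_of_relIndex_ne_zero h hi)
  -- Second isomorphism theorem, [S : L' ∩ S] = [L' + S : L'], followed by the tower L' ≤ L' + S ≤
  -- L.
  have h3 : L'.toAddSubgroup.relIndex S.toAddSubgroup *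
      (L' ⊔ S).toAddSubgroup.relIndex L.toAddSubgroup =
      L'.toAddSubgroup.relIndex L.toAddSubgroup := by
    rw [Submodule.sup_toAddSubgroup, ← AddSubgroup.relIndex_sup_left,
      AddSubgroup.relIndex_mul_relIndex _ _ _ le_sup_left (sup_le h hS)]
  rw [h1, e1, h2, ← h3]
  have := (latticeVolume_pos L).ne'
  rw [← h3] at hi
  obtain ⟨ha, hb⟩ := mul_ne_zero_iff.1 hi
  have ha' : (L'.toAddSubgroup.relIndex S.toAddSubgroup : ℝ) ≠ 0 := by exact_mod_cast ha
  have hb' : ((L' ⊔ S).toAddSubgroup.relIndex L.toAddSubgroup : ℝ) ≠ 0 := by exact_mod_cast hb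
  push_cast
  field_simp

theorem latticeDim_inf_eq {L' L S : Submodule ℤ (Euc d)} [DiscreteTopology L']
    [IsZLattice ℝ L'] [DiscreteTopology L] [IsZLattice ℝ L] (h : L' ≤ L) (hS : S ≤ L) :
    latticeDim (L' ⊓ S) = latticeDim S := by
  rw [latticeDim, latticeDim, span_eq_of_relIndex_ne_zero inf_le_right]
  rw [Submodule.toAddSubgroup_inf, AddSubgroup.inf_relIndex_right]
  exact mt (AddSubgroup.relIndex_eq_zero_of_le_right hS) (relIndex_ne_zero_of_isZLattice h)

/-- Covolumes and ball volumes are positive, so a shadow monomial never degenerates to 0 and its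
exponent and multiplicity can be read back from it. -/
theorem shadowMonomial_coeff_ne_zero (Λ : Submodule ℤ (Euc d)) [DiscreteTopology Λ]
    (C : Set (Euc d ⧸ Λ)) (q : ℕ) :
    latticeVolume (periodicityLattice Λ C) / latticeVolume Λ * unitBallVolume q ≠ 0 := by
  have : DiscreteTopology (periodicityLattice Λ C) :=
    Submodule.discreteTopology_of_le fun _ h => h.1
  exact mul_ne_zero (div_ne_zero (latticeVolume_pos _).ne' (latticeVolume_pos _).ne')
    (unitBallVolume_pos q).ne'

theorem natDegree_shadowMonomial (Λ : Submodule ℤ (Euc d)) [DiscreteTopology Λ]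
    (C : Set (Euc d ⧸ Λ)) :
    (shadowMonomial Λ C).natDegree = d - latticeDim (periodicityLattice Λ C) :=
  Polynomial.natDegree_monomial_eq _ (shadowMonomial_coeff_ne_zero Λ C _)

theorem leadingCoeff_shadowMonomial_div (Λ : Submodule ℤ (Euc d)) [DiscreteTopology Λ]
    (C : Set (Euc d ⧸ Λ)) :
    (shadowMonomial Λ C).leadingCoeff / unitBallVolume (shadowMonomial Λ C).natDegree =
      latticeVolume (periodicityLattice Λ C) / latticeVolume Λ := by
  rw [natDegree_shadowMonomial, shadowMonomial, Polynomial.leadingCoeff_monomial,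
    mul_div_cancel_right₀ _ (unitBallVolume_pos _).ne']

end Lattice

/-! ### Structure of merge trees -/

section Tame

variable {T : Type} [TopologicalSpace T] {X : ℝ → Set T}

namespace MergeTree

/-- The point of the merge tree at height `t` given by the component of `x`. -/
def mk (x : T) (t : ℝ) (hx : x ∈ X t) : MergeTree X := Quotient.mk _ ⟨(x, t), hx⟩

@[simp] theorem height_mk (x : T) (t : ℝ) (hx : x ∈ X t) : (mk x t hx).height = t := rfl

@[simp] theorem comp_mk (x : T) (t : ℝ) (hx : x ∈ X t) :
    (mk x t hx).comp = connectedComponentIn (X t) x := rfl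

theorem exists_eq_mk (A : MergeTree X) : ∃ x hx, A = mk x A.height hx := by
  induction A using Quotient.inductionOn with
  | h p => exact ⟨p.1.1, p.2, rfl⟩

theorem le_iff {A B : MergeTree X} : A ≤ B ↔ A.height ≤ B.height ∧ A.comp ⊆ B.comp := Iff.rfl

theorem eq_of_height_eq_of_comp_eq {A B : MergeTree X} (h : A.height = B.height)
    (hc : A.comp = B.comp) : A = B :=
  le_antisymm (le_iff.2 ⟨h.le, hc.le⟩) (le_iff.2 ⟨h.ge, hc.ge⟩)

theorem comp_subset (A : MergeTree X) : A.comp ⊆ X A.height := by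
  obtain ⟨x, hx, h⟩ := A.exists_eq_mk
  rw [h]
  exact connectedComponentIn_subset _ _

theorem comp_nonempty (A : MergeTree X) : A.comp.Nonempty := by
  obtain ⟨x, hx, h⟩ := A.exists_eq_mk
  rw [h]
  exact ⟨x, mem_connectedComponentIn hx⟩

theorem comp_eq_of_mem {A : MergeTree X} {y : T} (hy : y ∈ A.comp) :
    A.comp = connectedComponentIn (X A.height) y := by
  obtain ⟨x, hx, h⟩ := A.exists_eq_mk
  rw [h] at hy ⊢
  exact connectedComponentIn_eq hy

theorem le_of_mem_comp (hX : Monotone X) {A B : MergeTree X} {y : T} (hA : y ∈ A.comp)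
    (hB : y ∈ B.comp) (h : A.height ≤ B.height) : A ≤ B := by
  refine le_iff.2 ⟨h, ?_⟩
  rw [comp_eq_of_mem hA, comp_eq_of_mem hB]
  exact connectedComponentIn_mono _ (hX h)

/-- The tree property: the points above `G` form a chain, ordered by height, because their
components share the points of `G`. -/
theorem le_of_le_of_le (hX : Monotone X) {G A B : MergeTree X} (hA : G ≤ A) (hB : G ≤ B)
    (h : A.height ≤ B.height) : A ≤ B := by
  obtain ⟨y, hy⟩ := G.comp_nonempty
  exact le_of_mem_comp hX (hA.2 hy) (hB.2 hy) h

theorem eq_of_le_of_le (hX : Monotone X) {G A B : MergeTree X} (hA : G ≤ A) (hB : G ≤ B)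
    (h : A.height = B.height) : A = B :=
  le_antisymm (le_of_le_of_le hX hA hB h.le) (le_of_le_of_le hX hB hA h.ge)

theorem exists_ge_height_eq (hX : Monotone X) (A : MergeTree X) {t : ℝ} (ht : A.height ≤ t) :
    ∃ B, A ≤ B ∧ B.height = t := by
  obtain ⟨y, hy⟩ := A.comp_nonempty
  have hy' := hX ht (A.comp_subset hy)
  exact ⟨mk y t hy', le_of_mem_comp hX hy (mem_connectedComponentIn hy') ht, rfl⟩

/-- The minimum height of the points covered by `A`. -/
noncomputable def birth (A : MergeTree X) : ℝ := sInf (height '' Set.Iic A)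

end MergeTree

open MergeTree

/-- A family of sublevel sets that changes only at the finitely many critical values in `crit`,
and whose members have finitely many connected components. -/
structure IsTame (X : ℝ → Set T) (crit : Set ℝ) : Prop where
  mono : Monotone X
  finite : crit.Finite
  eq_of_disjoint : ∀ s t, s ≤ t → Disjoint crit (Set.Ioc s t) → X s = X t
  exists_le : ∀ t x, x ∈ X t → ∃ c ∈ crit, c ≤ t
  finite_height : ∀ t, {A : MergeTree X | A.height = t}.Finite

theorem Set.Finite.exists_floor {crit : Set ℝ} (hc : crit.Finite) {t : ℝ}
    (ht : ∃ c ∈ crit, c ≤ t) : ∃ c ∈ crit, c ≤ t ∧ Disjoint crit (Set.Ioc c t) := by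
  obtain ⟨c, ⟨hc1, hc2⟩, hmax⟩ := Set.exists_max_image (crit ∩ Set.Iic t) id
    (hc.inter_of_left _) (by obtain ⟨c, h1, h2⟩ := ht; exact ⟨c, h1, h2⟩)
  refine ⟨c, hc1, hc2, Set.disjoint_left.2 fun a ha hat => ?_⟩
  exact absurd (hmax a ⟨ha, hat.2⟩) (not_le.2 hat.1)

theorem Set.Finite.exists_gt_disjoint_Ioc {crit : Set ℝ} (hc : crit.Finite) (t : ℝ) :
    ∃ s, t < s ∧ Disjoint crit (Set.Ioc t s) := by
  have h := (hc.subset (Set.inter_subset_left (t := Set.Ioi t))).isClosed.isOpen_compl.mem_nhds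
    (show t ∈ (crit ∩ Set.Ioi t)ᶜ from fun h => lt_irrefl t h.2)
  obtain ⟨s, hs, h⟩ := mem_nhdsGE_iff_exists_Icc_subset.1 (mem_nhdsWithin_of_mem_nhds h)
  exact ⟨s, hs, Set.disjoint_left.2 fun a ha hat =>
    h ⟨hat.1.le, hat.2⟩ ⟨ha, hat.1⟩⟩

theorem Set.Finite.exists_lt_disjoint_Ico {crit : Set ℝ} (hc : crit.Finite) (t : ℝ) :
    ∃ s, s < t ∧ Disjoint crit (Set.Ico s t) := by
  have h := (hc.subset (Set.inter_subset_left (t := Set.Iio t))).isClosed.isOpen_compl.mem_nhds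
    (show t ∈ (crit ∩ Set.Iio t)ᶜ from fun h => lt_irrefl t h.2)
  obtain ⟨s, hs, h⟩ := mem_nhdsLE_iff_exists_Icc_subset.1 (mem_nhdsWithin_of_mem_nhds h)
  exact ⟨s, hs, Set.disjoint_left.2 fun a ha hat =>
    h ⟨hat.1, hat.2.le⟩ ⟨ha, hat.2⟩⟩

/-- A set of reals that is an interval and whose membership changes only at critical values is a
half-open interval with critical endpoints. -/
theorem halfOpen_of_critical {crit H : Set ℝ} (hc : crit.Finite) (hne : H.Nonempty)
    (hb : BddBelow H) (ho : H.OrdConnected)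
    (hH : ∀ s t, s ≤ t → Disjoint crit (Set.Ioc s t) → (s ∈ H ↔ t ∈ H)) :
    sInf H ∈ crit ∧
      (∀ c : ℝ, sSup ((fun h : ℝ => (h : WithTop ℝ)) '' H) = c → c ∈ crit) ∧
      ∀ h, h ∈ H ↔ sInf H ≤ h ∧ (h : WithTop ℝ) < sSup ((fun h : ℝ => (h : WithTop ℝ)) '' H) := by
  have hpre : ((fun h : ℝ => (h : WithTop ℝ)) ⁻¹' ((fun h : ℝ => (h : WithTop ℝ)) '' H)) = H :=
    Set.preimage_image_eq _ WithTop.coe_injective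
  -- Membership is constant just to the right of the infimum, so the infimum is attained.
  have hmin : sInf H ∈ H := by
    obtain ⟨s, hs, hd⟩ := hc.exists_gt_disjoint_Ioc (sInf H)
    obtain ⟨a, ha, has⟩ := exists_lt_of_csInf_lt hne hs
    exact (hH _ a (csInf_le hb ha) (hd.mono_right (Set.Ioc_subset_Ioc_right has.le))).2 ha
  -- Were the infimum not critical, membership would extend to its left.
  have hcrit : sInf H ∈ crit := by
    by_contra hn
    obtain ⟨s, hs, hd⟩ := hc.exists_lt_disjoint_Ico (sInf H)
    refine absurd (csInf_le hb ((hH s _ hs.le ?_).2 hmin)) (not_le.2 hs)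
    refine Set.disjoint_left.2 fun a ha hat => ?_
    rcases hat.2.eq_or_lt with h | h
    · exact hn (h ▸ ha)
    · exact Set.disjoint_left.1 hd ha ⟨hat.1.le, h⟩
  have htop : (⊤ : WithTop ℝ) ∉ (fun h : ℝ => (h : WithTop ℝ)) '' H := by
    rintro ⟨a, -, ha⟩
    exact WithTop.coe_ne_top ha
  by_cases hba : BddAbove H
  · have hs : sSup ((fun h : ℝ => (h : WithTop ℝ)) '' H) = ((sSup H : ℝ) : WithTop ℝ) := by
      rw [WithTop.sSup_eq htop (by rwa [hpre]), hpre]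
    -- If the supremum were a member, membership would persist slightly above it.
    have hnot : sSup H ∉ H := by
      intro hm
      obtain ⟨s, hs, hd⟩ := hc.exists_gt_disjoint_Ioc (sSup H)
      exact absurd (le_csSup hba ((hH _ s hs.le hd).1 hm)) (not_le.2 hs)
    rw [hs]
    refine ⟨hcrit, fun c hcs => ?_, fun h => ⟨fun hh => ⟨csInf_le hb hh, ?_⟩, fun hh => ?_⟩⟩
    · rw [← WithTop.coe_injective hcs]
      by_contra hn
      obtain ⟨s, hs, hd⟩ := hc.exists_lt_disjoint_Ico (sSup H)
      obtain ⟨a, ha, has⟩ := exists_lt_of_lt_csSup hne hs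
      refine hnot ((hH a _ (le_csSup hba ha) ?_).1 ha)
      refine Set.disjoint_left.2 fun b hb hbt => ?_
      rcases hbt.2.eq_or_lt with h | h
      · exact hn (h ▸ hb)
      · exact Set.disjoint_left.1 hd hb ⟨(has.trans hbt.1).le, h⟩
    · exact WithTop.coe_lt_coe.2 ((le_csSup hba hh).lt_of_ne fun h' => hnot (h' ▸ hh))
    · obtain ⟨a, ha, hha⟩ := exists_lt_of_lt_csSup hne (WithTop.coe_lt_coe.1 hh.2)
      exact ho.out hmin ha ⟨hh.1, hha.le⟩
  · rw [WithTop.sSup_of_not_bddAbove (by rwa [hpre])]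
    refine ⟨hcrit, fun c h => absurd h.symm WithTop.coe_ne_top, fun h =>
      ⟨fun hh => ⟨csInf_le hb hh, WithTop.coe_lt_top _⟩, fun hh => ?_⟩⟩
    obtain ⟨a, ha, hha⟩ := not_bddAbove_iff.1 hba h
    exact ho.out hmin ha ⟨hh.1, hha.le⟩

variable {crit : Set ℝ}

/-- The reason why ties do not matter: the right-hand side does not involve `e`. -/
theorem ElderRule.height_oldest (e : ElderRule (MergeTree.height (X := X))) (A : MergeTree X) : (e.oldest A).height = A.birth := by
  have hl : IsLeast (MergeTree.height '' Set.Iic A) (e.oldest A).height :=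
    ⟨⟨_, e.oldest_le A, rfl⟩, by rintro _ ⟨B, hB, rfl⟩; exact e.height_oldest_le A B hB⟩
  exact hl.csInf_eq.symm

namespace IsTame

theorem comp_eq (h : IsTame X crit) {A B : MergeTree X} (hBA : B ≤ A)
    (hd : Disjoint crit (Set.Ioc B.height A.height)) : B.comp = A.comp := by
  obtain ⟨y, hy⟩ := B.comp_nonempty
  rw [comp_eq_of_mem hy, comp_eq_of_mem (hBA.2 hy), h.eq_of_disjoint _ _ hBA.1 hd]

theorem exists_le_height_eq (h : IsTame X crit) (A : MergeTree X) {s : ℝ} (hs : s ≤ A.height)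
    (hd : Disjoint crit (Set.Ioc s A.height)) : ∃ B ≤ A, B.height = s := by
  obtain ⟨y, hy⟩ := A.comp_nonempty
  have hy' := A.comp_subset hy
  rw [← h.eq_of_disjoint _ _ hs hd] at hy'
  exact ⟨MergeTree.mk y s hy', le_of_mem_comp h.mono (mem_connectedComponentIn hy') hy hs, rfl⟩

/-- Nothing changes on the way down to the last critical value at or below `A`. -/
theorem exists_critical_le (h : IsTame X crit) (A : MergeTree X) :
    ∃ B ≤ A, B.height ∈ crit ∧ Disjoint crit (Set.Ioc B.height A.height) := by
  obtain ⟨y, hy⟩ := A.comp_nonempty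
  obtain ⟨c, hc, hcA, hd⟩ := h.finite.exists_floor (h.exists_le _ _ (A.comp_subset hy))
  obtain ⟨B, hB, rfl⟩ := h.exists_le_height_eq A hcA hd
  exact ⟨B, hB, hc, hd⟩

/-- Only points at critical heights compete, and these heights are finite in number. -/
theorem exists_min_height (h : IsTame X crit) (A : MergeTree X) : ∃ G ≤ A, ∀ B ≤ A, G.height ≤ B.height := by
  obtain ⟨B₀, h₀, hc₀, -⟩ := h.exists_critical_le A
  obtain ⟨c, ⟨hc, G, hG, rfl⟩, hmin⟩ := Set.exists_min_image
    {c | c ∈ crit ∧ ∃ B ≤ A, B.height = c} id (h.finite.subset fun _ hc => hc.1)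
    ⟨_, hc₀, B₀, h₀, rfl⟩
  refine ⟨G, hG, fun B hB => ?_⟩
  obtain ⟨B', h', hc', -⟩ := h.exists_critical_le B
  exact (hmin _ ⟨hc', B', h'.trans hB, rfl⟩).trans h'.1

/-- An elder rule exists: ties are broken by a well-ordering of the tree. -/
theorem nonempty_elderRule (h : IsTame X crit) :
    Nonempty (ElderRule (MergeTree.height (X := X))) := by
  classical
  let r := WellOrderingRel (α := MergeTree X)
  have hwf : WellFounded r := WellOrderingRel.isWellOrder.wf
  let S : MergeTree X → Set (MergeTree X) := fun A =>
    {G | G ≤ A ∧ ∀ B ≤ A, G.height ≤ B.height}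
  have hS : ∀ A, (S A).Nonempty := h.exists_min_height
  have hmem : ∀ A, hwf.min (S A) (hS A) ∈ S A := fun A => hwf.min_mem _ _
  refine ⟨⟨fun A => hwf.min (S A) (hS A), fun A => (hmem A).1, fun A => (hmem A).2, ?_⟩⟩
  intro A B h1 h2
  set G := hwf.min (S A) (hS A) with hG
  -- The choices for `A` and for `B` are each a candidate for the other point, so neither precedes
  -- the other in the well-ordering.
  have hGB : G ∈ S B := ⟨h1, fun D hD => (hmem A).2 D (hD.trans h2)⟩
  have hBA : hwf.min (S B) (hS B) ∈ S A :=
    ⟨(hmem B).1.trans h2, fun D hD => ((hmem B).2 G h1).trans ((hmem A).2 D hD)⟩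
  rcases trichotomous_of r (hwf.min (S B) (hS B)) G with h3 | h3 | h3
  · exact absurd h3 (hwf.not_lt_min _ hBA)
  · exact h3
  · exact absurd h3 (hwf.not_lt_min _ hGB)


theorem height_oldest_mem (h : IsTame X crit)
    (e : ElderRule (MergeTree.height (X := X))) (A : MergeTree X) : (e.oldest A).height ∈ crit := by
  obtain ⟨B, hB, hc, -⟩ := h.exists_critical_le (e.oldest A)
  rwa [le_antisymm (e.height_oldest_le A B (hB.trans (e.oldest_le A))) hB.1]

/-- The oldest point has critical height, so it cannot be born strictly after `B`; it is therefore
below `B`, and beams are uninterrupted. -/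
theorem oldest_eq_of_disjoint (h : IsTame X crit)
    (e : ElderRule (MergeTree.height (X := X))) {A B : MergeTree X} (hBA : B ≤ A)
    (hd : Disjoint crit (Set.Ioc B.height A.height)) : e.oldest B = e.oldest A := by
  have hG := e.oldest_le A
  refine e.oldest_eq A B (le_iff.2 ⟨?_, (h.comp_eq hBA hd).symm ▸ hG.2⟩) hBA
  by_contra hlt
  exact Set.disjoint_left.1 hd (h.height_oldest_mem e A) ⟨not_le.1 hlt, hG.1⟩

end IsTame
end Tame

/-! ### The barcode of a tame merge tree -/

section Epochs

open MergeTree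

variable {T : Type} [TopologicalSpace T] {X : ℝ → Set T} {crit : Set ℝ}
  {e : ElderRule (MergeTree.height (X := X))} {g : Set T → ℝ[X]} {freq : MergeTree X → ℝ[X]}

/-- The points on the beam of `A` that are not separated from `A` by a change of the frequency. -/
def epochSet (e : ElderRule (MergeTree.height (X := X))) (freq : MergeTree X → ℝ[X])
    (A : MergeTree X) : Set (MergeTree X) :=
  {B | e.oldest B = e.oldest A ∧ ∀ D, (A ≤ D ∧ D ≤ B) ∨ (B ≤ D ∧ D ≤ A) → freq D = freq A}

theorem mem_epochSet_self (A : MergeTree X) : A ∈ epochSet e freq A := by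
  refine ⟨rfl, fun D hD => ?_⟩
  rcases hD with hD | hD <;> rw [le_antisymm hD.1 hD.2]

theorem le_total_of_oldest_eq (hX : Monotone X) {A B : MergeTree X}
    (h : e.oldest A = e.oldest B) : A ≤ B ∨ B ≤ A := by
  have hB : e.oldest A ≤ B := h ▸ e.oldest_le B
  rcases le_total A.height B.height with h' | h'
  · exact .inl (le_of_le_of_le hX (e.oldest_le A) hB h')
  · exact .inr (le_of_le_of_le hX hB (e.oldest_le A) h')

theorem freq_eq_of_mem_epochSet (hX : Monotone X) {A B : MergeTree X}
    (h : B ∈ epochSet e freq A) : freq B = freq A := by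
  refine h.2 B ?_
  rcases le_total_of_oldest_eq hX h.1 with h' | h'
  · exact .inr ⟨le_rfl, h'⟩
  · exact .inl ⟨h', le_rfl⟩

theorem ordConnected_epochSet (A : MergeTree X) :
    (epochSet e freq A).OrdConnected := by
  refine ⟨fun B₁ h₁ B₂ h₂ D hD => ?_⟩
  have hB : e.oldest B₂ ≤ D := by
    rw [h₂.1, ← h₁.1]
    exact (e.oldest_le B₁).trans hD.1
  have hol : e.oldest D = e.oldest A := (e.oldest_eq B₂ D hB hD.2).trans h₂.1
  refine ⟨hol, fun C hC => ?_⟩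
  rcases hC with hC | hC
  · exact h₂.2 C (.inl ⟨hC.1, hC.2.trans hD.2⟩)
  · exact h₁.2 C (.inr ⟨hD.1.trans hC.1, hC.2⟩)

theorem subset_epochSet {S : Set (MergeTree X)} {leaf : MergeTree X} {label : ℝ[X]}
    (ho : S.OrdConnected) (hS : ∀ A ∈ S, e.oldest A = leaf ∧ freq A = label)
    {A : MergeTree X} (hA : A ∈ S) : S ⊆ epochSet e freq A := by
  refine fun B hB => ⟨(hS B hB).1.trans (hS A hA).1.symm, fun D hD => ?_⟩
  have hDS : D ∈ S := by
    rcases hD with hD | hD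
    · exact ho.out hA hB hD
    · exact ho.out hB hA hD
  exact (hS D hDS).2.trans (hS A hA).2.symm

/-- The epoch that contains a given point. -/
def epochOf (hX : Monotone X) (e : ElderRule (MergeTree.height (X := X)))
    (freq : MergeTree X → ℝ[X]) (A : MergeTree X) : Epoch e freq where
  leaf := e.oldest A
  label := freq A
  points := epochSet e freq A
  maximal := by
    refine ⟨⟨⟨A, mem_epochSet_self A⟩, ordConnected_epochSet A,
      fun B hB => ⟨hB.1, freq_eq_of_mem_epochSet hX hB⟩⟩, fun S hS hle => ?_⟩
    exact subset_epochSet hS.2.1 hS.2.2 (hle (mem_epochSet_self A))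

/-- By maximality the epochs partition the tree. -/
theorem eq_epochOf_of_mem (hX : Monotone X) {A : MergeTree X} {E : Epoch e freq}
    (hA : A ∈ E.points) : E = epochOf hX e freq A := by
  have hE := E.maximal
  have h1 : E.points = epochSet e freq A :=
    hE.eq_of_subset (epochOf hX e freq A |>.maximal.prop.imp_right fun h => ⟨h.1, fun B hB => by
      rw [← (hE.prop.2.2 A hA).1, ← (hE.prop.2.2 A hA).2] at *
      exact h.2 B hB⟩) (subset_epochSet hE.prop.2.1 hE.prop.2.2 hA)
  cases E with
  | mk leaf label points maximal =>
    obtain ⟨rfl, rfl⟩ := hE.prop.2.2 A hA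
    subst h1
    rfl

theorem mem_points_epochOf (hX : Monotone X) (A : MergeTree X) :
    A ∈ (epochOf hX e freq A).points := mem_epochSet_self A

theorem mem_points_iff (hX : Monotone X) {A : MergeTree X} {E : Epoch e freq} :
    A ∈ E.points ↔ epochOf hX e freq A = E :=
  ⟨fun h => (eq_epochOf_of_mem hX h).symm, fun h => h ▸ mem_points_epochOf hX A⟩

/-- A label of the form `g A.comp`, such as the shadow monomial, can change only when the component
does. -/
theorem epochOf_eq_of_disjoint (h : IsTame X crit) {A B : MergeTree X}
    (hBA : B ≤ A) (hd : Disjoint crit (Set.Ioc B.height A.height)) :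
    epochOf h.mono e (fun A => g A.comp) B = epochOf h.mono e (fun A => g A.comp) A := by
  rw [← mem_points_iff h.mono]
  refine ⟨h.oldest_eq_of_disjoint e hBA hd, fun D hD => ?_⟩
  rcases hD with hD | hD
  · rw [le_antisymm (hD.2.trans hBA) hD.1]
  · exact congrArg g (h.comp_eq hD.2 (hd.mono_right (Set.Ioc_subset_Ioc_left hD.1.1)))

/-- Every epoch contains one of the finitely many points at critical heights. -/
theorem finite_epoch (h : IsTame X crit) (e : ElderRule (MergeTree.height (X := X)))
    (g : Set T → ℝ[X]) : Finite (Epoch e (fun A => g A.comp)) := by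
  have hfin : (⋃ c ∈ crit, {A : MergeTree X | A.height = c}).Finite :=
    h.finite.biUnion fun c _ => h.finite_height c
  refine Set.finite_univ_iff.1 ((hfin.image (epochOf h.mono e (fun A => g A.comp))).subset ?_)
  rintro E -
  obtain ⟨A, hA⟩ := E.maximal.prop.1
  obtain ⟨B, hB, hc, hd⟩ := h.exists_critical_le A
  exact ⟨B, Set.mem_biUnion hc rfl,
    (epochOf_eq_of_disjoint h hB hd).trans ((mem_points_iff h.mono).1 hA)⟩

/-! ### Epochs as half-open intervals of heights -/

namespace Epoch

/-- The heights of the points of an epoch. -/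
def heights (E : Epoch e freq) : Set ℝ := MergeTree.height '' E.points

theorem finish_eq (E : Epoch e freq) :
    E.finish = sSup ((fun h : ℝ => (h : WithTop ℝ)) '' E.heights) := by
  rw [finish, heights, Set.image_image]

theorem oldest_eq (E : Epoch e freq) {A : MergeTree X} (hA : A ∈ E.points) :
    e.oldest A = E.leaf := (E.maximal.prop.2.2 A hA).1

theorem birth_le (E : Epoch e freq) {t : ℝ} (ht : t ∈ E.heights) : E.birth ≤ t := by
  obtain ⟨A, hA, rfl⟩ := ht
  rw [birth, ← E.oldest_eq hA]
  exact (e.oldest_le A).1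

theorem heights_nonempty (E : Epoch e freq) : E.heights.Nonempty := E.maximal.prop.1.image _

theorem ordConnected_heights (hX : Monotone X) (E : Epoch e freq) : E.heights.OrdConnected := by
  refine ⟨?_⟩
  rintro _ ⟨A, hA, rfl⟩ _ ⟨B, hB, rfl⟩ t ht
  obtain ⟨D, hD, rfl⟩ := exists_ge_height_eq hX A ht.1
  have hG : E.leaf ≤ A := E.oldest_eq hA ▸ e.oldest_le A
  have hG' : E.leaf ≤ B := E.oldest_eq hB ▸ e.oldest_le B
  exact ⟨D, E.maximal.prop.2.1.out hA hB ⟨hD, le_of_le_of_le hX (hG.trans hD) hG' ht.2⟩, rfl⟩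

theorem mem_heights_iff_of_disjoint (h : IsTame X crit) (E : Epoch e (fun A => g A.comp)) {s t : ℝ}
    (hst : s ≤ t) (hd : Disjoint crit (Set.Ioc s t)) : s ∈ E.heights ↔ t ∈ E.heights := by
  constructor
  · rintro ⟨A, hA, rfl⟩
    obtain ⟨B, hB, rfl⟩ := exists_ge_height_eq h.mono A hst
    refine ⟨B, ?_, rfl⟩
    rw [mem_points_iff h.mono] at hA ⊢
    rw [← hA, epochOf_eq_of_disjoint h hB hd]
  · rintro ⟨A, hA, rfl⟩
    obtain ⟨B, hB, rfl⟩ := h.exists_le_height_eq A hst hd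
    refine ⟨B, ?_, rfl⟩
    rw [mem_points_iff h.mono] at hA ⊢
    rw [← hA, epochOf_eq_of_disjoint h hB hd]

theorem halfOpen (h : IsTame X crit) (E : Epoch e (fun A => g A.comp)) :
    E.start ∈ crit ∧ (∀ c : ℝ, E.finish = c → c ∈ crit) ∧
      ∀ t, t ∈ E.heights ↔ E.start ≤ t ∧ (t : WithTop ℝ) < E.finish := by
  rw [finish_eq]
  exact halfOpen_of_critical h.finite E.heights_nonempty ⟨E.birth, fun _ ht => E.birth_le ht⟩
    (E.ordConnected_heights h.mono) fun s t => E.mem_heights_iff_of_disjoint h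

theorem start_mem_heights (h : IsTame X crit) (E : Epoch e (fun A => g A.comp)) :
    E.start ∈ E.heights := by
  obtain ⟨-, -, h3⟩ := E.halfOpen h
  obtain ⟨t, ht⟩ := E.heights_nonempty
  have ht' := (h3 t).1 ht
  exact (h3 _).2 ⟨le_rfl, (WithTop.coe_le_coe.2 ht'.1).trans_lt ht'.2⟩

open Classical in
/-- The contribution of an epoch to the era `q` of the bars born at `b`. -/
noncomputable def weight (q : ℕ) (b : ℝ) (E : Epoch e freq) : ℝ :=
  if E.exponent = q ∧ E.birth = b then E.multiplicity else 0

end Epoch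

open Classical in
/-- The total multiplicity, at height `t`, of the points in era `q` that are born at `b`. -/
noncomputable def eraDensity (freq : MergeTree X → ℝ[X]) (q : ℕ) (b t : ℝ) : ℝ :=
  ∑ᶠ (A : MergeTree X) (_ : A ∈ {A : MergeTree X | A.height = t}),
    if (freq A).natDegree = q ∧ A.birth = b then
      (freq A).leadingCoeff / unitBallVolume (freq A).natDegree else 0

open Classical in
-- A beam meets each height at most once, so `epochOf` matches the points at height `t` with the
-- epochs alive at `t`. This is where the elder rule drops out.
theorem finsum_weight (hX : Monotone X) (e : ElderRule (MergeTree.height (X := X)))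
    (freq : MergeTree X → ℝ[X]) (q : ℕ) (b t : ℝ) :
    ∑ᶠ E : Epoch e freq, (if t ∈ E.heights then E.weight q b else 0) =
      eraDensity freq q b t := by
  have h1 : ∑ᶠ E : Epoch e freq, (if t ∈ E.heights then E.weight q b else 0) =
      ∑ᶠ (E : Epoch e freq) (_ : E ∈ {E : Epoch e freq | t ∈ E.heights}), E.weight q b :=
    finsum_congr fun E => (finsum_eq_if (p := t ∈ E.heights)).symm
  rw [h1, eraDensity]
  refine (finsum_mem_eq_of_bijOn (epochOf hX e freq) ⟨?_, ?_, ?_⟩ ?_).symm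
  · intro A hA
    exact ⟨A, mem_points_epochOf hX A, hA⟩
  · intro A hA B hB hAB
    have ho : e.oldest A = e.oldest B := congrArg Epoch.leaf hAB
    exact eq_of_le_of_le hX (e.oldest_le A) (ho ▸ e.oldest_le B) (hA.trans hB.symm)
  · rintro E ⟨A, hA, rfl⟩
    exact ⟨A, rfl, (mem_points_iff hX).1 hA⟩
  · intro A _
    rw [← e.height_oldest]
    rfl

/-! ### Multiplicities of bars as jumps of the era density -/

variable {d : ℕ}

/-- Every bar is nonempty: an epoch satisfies birth ≤ start < finish, and the negative bar is
skipped if birth = start. -/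
theorem barcode_of_le (h : IsTame X crit) (e : ElderRule (MergeTree.height (X := X)))
    (g : Set T → ℝ[X]) (q : Fin (d + 1)) {b x : ℝ} (hx : x ≤ b) :
    barcode d e (fun A => g A.comp) q (b, (x : WithTop ℝ)) = 0 := by
  refine (finsum_congr fun E => ?_).trans finsum_zero
  obtain ⟨-, -, h3⟩ := E.halfOpen h
  have hs := E.start_mem_heights h
  have hb := E.birth_le hs
  have h1 : ¬ ((b, (x : WithTop ℝ)) = (E.birth, E.finish)) := by
    rintro h1
    have hlt := ((h3 _).1 hs).2
    rw [Prod.mk.injEq] at h1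
    rw [← h1.2] at hlt
    have := WithTop.coe_lt_coe.1 hlt
    linarith [h1.1]
  have h2 : ¬ (E.birth < E.start ∧ (b, (x : WithTop ℝ)) = (E.birth, (E.start : WithTop ℝ))) := by
    rintro ⟨h4, h5⟩
    rw [Prod.mk.injEq] at h5
    linarith [h5.1, WithTop.coe_injective h5.2]
  rw [if_neg h1, if_neg h2, add_zero, ite_self]

/-- Here `y` stands for a height just before `x`. An epoch ending at `x` is alive at `y` but not at
`x`, and conversely for one starting at `x`; these are the signs of its two bars. -/
theorem barcode_coe (h : IsTame X crit) (e : ElderRule (MergeTree.height (X := X)))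
    (g : Set T → ℝ[X]) (q : Fin (d + 1)) {b x y : ℝ} (hx : b < x) (hy : y < x)
    (hd : Disjoint crit (Set.Ico y x)) :
    barcode d e (fun A => g A.comp) q (b, (x : WithTop ℝ)) =
      eraDensity (X := X) (fun A => g A.comp) q b y -
        eraDensity (X := X) (fun A => g A.comp) q b x := by
  classical
  have := finite_epoch h e g
  rw [← finsum_weight h.mono e, ← finsum_weight h.mono e,
    ← finsum_sub_distrib (Set.toFinite _) (Set.toFinite _)]
  refine finsum_congr fun E => ?_
  obtain ⟨h1, h2, h3⟩ := E.halfOpen h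
  by_cases hq : E.exponent = q
  swap
  · simp [Epoch.weight, hq]
  by_cases hb : E.birth = b
  swap
  · simp [Epoch.weight, hb, Prod.ext_iff, Ne.symm hb]
  have hlt := ((h3 _).1 (E.start_mem_heights h)).2
  simp only [hq, hb, Epoch.weight, Prod.mk.injEq, true_and, h3, if_true, and_self]
  -- An epoch whose start or end precedes `x` has already started or ended before `y`, so it does
  -- not contribute to the jump at `x` by that endpoint.
  have hnot : ∀ c ∈ crit, c < x → c < y := fun c hc hcx => by
    by_contra hcy
    exact Set.disjoint_left.1 hd hc ⟨not_lt.1 hcy, hcx⟩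
  by_cases hcf : E.finish = ⊤
  · rw [hcf]
    simp only [WithTop.coe_lt_top, and_true, WithTop.coe_ne_top, if_false, zero_add,
      WithTop.coe_inj]
    rcases lt_trichotomy x E.start with hlt' | rfl | hlt'
    · simp [hlt'.ne, not_le.2 hlt', not_le.2 (hy.trans hlt')]
    -- The epoch starts at `x`, and `b < x` guarantees that its negative bar is not skipped.
    · simp [hx, not_le.2 hy]
    · simp [hlt'.ne', hlt'.le, (hnot _ h1 hlt').le]
  · obtain ⟨c, hc⟩ := WithTop.ne_top_iff_exists.1 hcf
    have hcm := h2 c hc.symm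
    rw [← hc] at hlt ⊢
    simp only [WithTop.coe_lt_coe, WithTop.coe_inj] at hlt ⊢
    rcases lt_trichotomy x E.start with hlt' | rfl | hlt'
    · simp [hlt'.ne, not_le.2 hlt', not_le.2 (hy.trans hlt'), (hlt'.trans hlt).ne]
    · simp [hx, not_le.2 hy, hlt, hlt.ne]
    · rcases lt_trichotomy x c with hc' | rfl | hc'
      · simp [hlt'.ne', hlt'.le, (hnot _ h1 hlt').le, hc', hc'.ne, hy.trans hc']
      · simp [hlt'.ne', (hnot _ h1 hlt').le, hy]
      · simp [hlt'.ne', hc'.ne', not_lt.2 hc'.le, not_lt.2 (hnot _ hcm hc').le]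

/-- Above all critical values exactly the epochs that never end are alive. -/
theorem barcode_top (h : IsTame X crit) (e : ElderRule (MergeTree.height (X := X)))
    (g : Set T → ℝ[X]) (q : Fin (d + 1)) {b t : ℝ} (ht : ∀ c ∈ crit, c ≤ t) :
    barcode d e (fun A => g A.comp) q (b, ⊤) =
      eraDensity (X := X) (fun A => g A.comp) q b t := by
  classical
  rw [← finsum_weight h.mono e]
  refine finsum_congr fun E => ?_
  obtain ⟨h1, h2, h3⟩ := E.halfOpen h
  have hfin : E.finish = ⊤ ↔ t ∈ E.heights := by
    rw [h3]
    refine ⟨fun hf => ⟨ht _ h1, hf ▸ WithTop.coe_lt_top t⟩, fun hf => ?_⟩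
    by_contra hne
    obtain ⟨c, hc⟩ := WithTop.ne_top_iff_exists.1 hne
    rw [← hc] at hf
    exact absurd (ht c (h2 c hc.symm)) (not_le.2 (WithTop.coe_lt_coe.1 hf.2))
  by_cases hq : E.exponent = q
  swap
  · simp [Epoch.weight, hq]
  by_cases hb : E.birth = b
  swap
  · simp [Epoch.weight, hb, Prod.ext_iff, Ne.symm hb]
  simp [hq, hb, Epoch.weight, ← hfin, eq_comm]

/-- The barcode depends only on the era densities, and not on the elder rule. -/
theorem barcode_eq_of_eraDensity_eq {T' : Type} [TopologicalSpace T'] {X' : ℝ → Set T'}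
    (h : IsTame X crit) (h' : IsTame X' crit) (e : ElderRule (MergeTree.height (X := X)))
    (e' : ElderRule (MergeTree.height (X := X'))) (g : Set T → ℝ[X]) (g' : Set T' → ℝ[X])
    (hN : ∀ q b t, eraDensity (X := X) (fun A => g A.comp) q b t =
      eraDensity (X := X') (fun A => g' A.comp) q b t) :
    barcode d e (fun A => g A.comp) = barcode d e' (fun A => g' A.comp) := by
  funext q z
  obtain ⟨b, x⟩ := z
  induction x using WithTop.recTopCoe with
  | top =>
    obtain ⟨t, ht⟩ := h.finite.bddAbove
    rw [barcode_top h e g q fun c hc => ht hc, barcode_top h' e' g' q fun c hc => ht hc, hN]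
  | coe x =>
    rcases le_or_gt x b with hx | hx
    · rw [barcode_of_le h e g q hx, barcode_of_le h' e' g' q hx]
    · obtain ⟨y, hy, hd⟩ := h.finite.exists_lt_disjoint_Ico x
      rw [barcode_coe h e g q hx hy hd, barcode_coe h' e' g' q hx hy hd, hN, hN]

end Epochs

/-! ### Sublevel sets of periodic filters -/

section Sublevel

open MergeTree

variable {d : ℕ}

/-- The union of the cells on which `f` is at most `t`. -/
def sublevel (K : CellComplex d) (f : K.cells → ℝ) (t : ℝ) : Set (Euc d) :=
  ⋃ σ ∈ {σ : K.cells | f σ ≤ t}, (σ : Set (Euc d))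

variable {K : CellComplex d} {f : K.cells → ℝ} {Λ : Submodule ℤ (Euc d)} {t : ℝ}

theorem mem_sublevel {x : Euc d} :
    x ∈ sublevel K f t ↔ ∃ σ : K.cells, f σ ≤ t ∧ x ∈ (σ : Set (Euc d)) := by
  simp [sublevel]

theorem image_sublevel : Λ.mkQ '' sublevel K f t = quotientSublevel K f Λ t := by
  rw [sublevel, quotientSublevel, Set.image_iUnion₂]

theorem CellComplex.isCompact_cell (σ : K.cells) : IsCompact (σ : Set (Euc d)) := by
  obtain ⟨h, -⟩ := K.isClosedCell σ
  have : CompactSpace (Metric.closedBall (0 : Euc (K.dim σ)) 1) :=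
    isCompact_iff_compactSpace.1 (isCompact_closedBall _ _)
  exact isCompact_iff_compactSpace.2 h.compactSpace

theorem CellComplex.isConnected_cell (σ : K.cells) : IsConnected (σ : Set (Euc d)) := by
  obtain ⟨h, -⟩ := K.isClosedCell σ
  have : ConnectedSpace (Metric.closedBall (0 : Euc (K.dim σ)) 1) :=
    isConnected_iff_connectedSpace.1
      ⟨⟨0, by simp⟩, (convex_closedBall _ _).isPreconnected⟩
  exact isConnected_iff_connectedSpace.2 (h.surjective.connectedSpace h.continuous)

theorem CellComplex.IsPeriodic.mono {Λ' : Submodule ℤ (Euc d)} (h : K.IsPeriodic Λ)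
    (hle : Λ' ≤ Λ) : K.IsPeriodic Λ' := fun σ hσ u hu => h σ hσ u (hle hu)

theorem CellComplex.IsPeriodicFun.mono {Λ' : Submodule ℤ (Euc d)} (h : K.IsPeriodicFun f Λ)
    (hle : Λ' ≤ Λ) : K.IsPeriodicFun f Λ' := fun σ τ u hu => h σ τ u (hle hu)

theorem add_mem_sublevel (hK : K.IsPeriodic Λ) (hf : K.IsPeriodicFun f Λ) {u x : Euc d}
    (hu : u ∈ Λ) (hx : x ∈ sublevel K f t) : u + x ∈ sublevel K f t := by
  obtain ⟨σ, hσ, hx⟩ := mem_sublevel.1 hx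
  exact mem_sublevel.2 ⟨⟨u +ᵥ (σ : Set (Euc d)), hK σ σ.2 u hu⟩,
    (hf σ _ u hu rfl).trans_le hσ, Set.vadd_mem_vadd_set hx⟩

theorem add_mem_sublevel_iff (hK : K.IsPeriodic Λ) (hf : K.IsPeriodicFun f Λ) {u x : Euc d}
    (hu : u ∈ Λ) : u + x ∈ sublevel K f t ↔ x ∈ sublevel K f t := by
  refine ⟨fun h => ?_, add_mem_sublevel hK hf hu⟩
  simpa using add_mem_sublevel hK hf (Λ.neg_mem hu) h

theorem mkQ_eq_mkQ_iff {x y : Euc d} : Λ.mkQ x = Λ.mkQ y ↔ ∃ u ∈ Λ, u + x = y := by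
  rw [Submodule.mkQ_apply, Submodule.mkQ_apply, eq_comm, Submodule.Quotient.eq]
  exact ⟨fun h => ⟨_, h, sub_add_cancel y x⟩, fun ⟨u, hu, h⟩ => h ▸ by simpa⟩

theorem mkQ_mem_quotientSublevel_iff (hK : K.IsPeriodic Λ) (hf : K.IsPeriodicFun f Λ)
    {x : Euc d} : Λ.mkQ x ∈ quotientSublevel K f Λ t ↔ x ∈ sublevel K f t := by
  rw [← image_sublevel]
  refine ⟨?_, Set.mem_image_of_mem _⟩
  rintro ⟨y, hy, hxy⟩
  obtain ⟨u, hu, rfl⟩ := mkQ_eq_mkQ_iff.1 hxy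
  exact add_mem_sublevel hK hf hu hy

theorem image_add_sublevel (hK : K.IsPeriodic Λ) (hf : K.IsPeriodicFun f Λ) {u : Euc d}
    (hu : u ∈ Λ) : (u + ·) '' sublevel K f t = sublevel K f t := by
  ext y
  constructor
  · rintro ⟨x, hx, rfl⟩
    exact add_mem_sublevel hK hf hu hx
  · intro hy
    exact ⟨-u + y, add_mem_sublevel hK hf (Λ.neg_mem hu) hy, by simp⟩

theorem vadd_connectedComponentIn (hK : K.IsPeriodic Λ) (hf : K.IsPeriodicFun f Λ) {u x : Euc d}
    (hu : u ∈ Λ) (hx : x ∈ sublevel K f t) :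
    u +ᵥ connectedComponentIn (sublevel K f t) x =
      connectedComponentIn (sublevel K f t) (u + x) := by
  have h := (Homeomorph.addLeft u).image_connectedComponentIn hx
  simp only [Homeomorph.coe_addLeft] at h
  rwa [image_add_sublevel hK hf hu] at h

theorem add_mem_connectedComponentIn_iff (hK : K.IsPeriodic Λ) (hf : K.IsPeriodicFun f Λ)
    {u x y : Euc d} (hu : u ∈ Λ) (hx : x ∈ sublevel K f t) :
    u + y ∈ connectedComponentIn (sublevel K f t) (u + x) ↔
      y ∈ connectedComponentIn (sublevel K f t) x := by
  rw [← vadd_connectedComponentIn hK hf hu hx, ← vadd_eq_add, Set.vadd_mem_vadd_set_iff]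

/-- Such a set is a union of a locally finite family of compact cells. -/
theorem isClosed_of_forall_cell {D : Set (Euc d)} (hD : D ⊆ sublevel K f t)
    (h : ∀ σ : K.cells, f σ ≤ t → ((σ : Set (Euc d)) ∩ D).Nonempty → (σ : Set (Euc d)) ⊆ D) :
    IsClosed D := by
  have hD' : D = ⋃ σ : {σ : K.cells // f σ ≤ t ∧ ((σ : Set (Euc d)) ∩ D).Nonempty},
      ((σ : K.cells) : Set (Euc d)) := by
    refine Set.Subset.antisymm (fun x hx => ?_) (Set.iUnion_subset fun σ => h σ σ.2.1 σ.2.2)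
    obtain ⟨σ, hσ, hxσ⟩ := mem_sublevel.1 (hD hx)
    exact Set.mem_iUnion.2 ⟨⟨σ, hσ, x, hxσ, hx⟩, hxσ⟩
  rw [hD']
  exact (K.locallyFinite.comp_injective Subtype.val_injective).isClosed_iUnion
    fun σ => (K.isCompact_cell _).isClosed

theorem cell_subset_connectedComponentIn {σ : K.cells} (hσ : f σ ≤ t) {x : Euc d}
    (hx : x ∈ (σ : Set (Euc d))) :
    (σ : Set (Euc d)) ⊆ connectedComponentIn (sublevel K f t) x :=
  (K.isConnected_cell σ).isPreconnected.subset_connectedComponentIn hx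
    fun _ hy => mem_sublevel.2 ⟨σ, hσ, hy⟩

/-- The preimage of a component in the torus is the union of the translates of a component in
Euclidean space. -/
theorem mkQ_mem_connectedComponentIn_iff (hK : K.IsPeriodic Λ) (hf : K.IsPeriodicFun f Λ)
    {x y : Euc d} (hx : x ∈ sublevel K f t) :
    Λ.mkQ y ∈ connectedComponentIn (quotientSublevel K f Λ t) (Λ.mkQ x) ↔
      ∃ u ∈ Λ, u + y ∈ connectedComponentIn (sublevel K f t) x := by
  have hxq := (mkQ_mem_quotientSublevel_iff hK hf).2 hx
  set c := connectedComponentIn (sublevel K f t) x with hc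
  constructor
  -- Both `D` and the rest of the sublevel set are Λ-invariant unions of cells. Their images in the
  -- torus are therefore closed and disjoint and cover the quotient sublevel set, so a connected
  -- component cannot meet both.
  · set D : Set (Euc d) := {y | ∃ u ∈ Λ, u + y ∈ c} with hD
    have hDs : D ⊆ sublevel K f t := by
      rintro y ⟨u, hu, hy⟩
      exact (add_mem_sublevel_iff hK hf hu).1 (connectedComponentIn_subset _ _ hy)
    have hDcell : ∀ σ : K.cells, f σ ≤ t → ((σ : Set (Euc d)) ∩ D).Nonempty →
        (σ : Set (Euc d)) ⊆ D := by
      rintro σ hσ ⟨y, hyσ, u, hu, hy⟩ z hz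
      refine ⟨u, hu, ?_⟩
      rw [hc, connectedComponentIn_eq hy, add_mem_connectedComponentIn_iff hK hf hu
        (mem_sublevel.2 ⟨σ, hσ, hyσ⟩)]
      exact cell_subset_connectedComponentIn hσ hyσ hz
    have hDclosed : IsClosed D := isClosed_of_forall_cell hDs hDcell
    have hRclosed : IsClosed (sublevel K f t \ D) := by
      refine isClosed_of_forall_cell Set.sdiff_subset fun σ hσ ⟨z, hzσ, hz⟩ w hw =>
        ⟨mem_sublevel.2 ⟨σ, hσ, hw⟩, fun hwD => hz.2 (hDcell σ hσ ⟨w, hw, hwD⟩ hzσ)⟩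
    have hDinv : ∀ u ∈ Λ, ∀ y, u + y ∈ D → y ∈ D := by
      rintro u hu y ⟨v, hv, h⟩
      exact ⟨v + u, Λ.add_mem hv hu, by rwa [add_assoc]⟩
    have hpre : ∀ S : Set (Euc d), (∀ u ∈ Λ, ∀ y, u + y ∈ S → y ∈ S) →
        Λ.mkQ ⁻¹' (Λ.mkQ '' S) = S := by
      refine fun S hS => Set.Subset.antisymm ?_ (Set.subset_preimage_image _ _)
      rintro z ⟨w, hw, hwz⟩
      obtain ⟨u, hu, rfl⟩ := mkQ_eq_mkQ_iff.1 hwz.symm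
      exact hS u hu z hw
    have hRinv : ∀ u ∈ Λ, ∀ y, u + y ∈ sublevel K f t \ D → y ∈ sublevel K f t \ D := by
      rintro u hu y ⟨h1, h2⟩
      refine ⟨(add_mem_sublevel_iff hK hf hu).1 h1, fun hy => h2 (hDinv (-u) (Λ.neg_mem hu) _ ?_)⟩
      rwa [neg_add_cancel_left]
    have hcl : ∀ S : Set (Euc d), (∀ u ∈ Λ, ∀ y, u + y ∈ S → y ∈ S) → IsClosed S →
        IsClosed (Λ.mkQ '' S) := fun S hS hSc => by
      rwa [← Λ.isQuotientMap_mkQ.isClosed_preimage, hpre S hS]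
    have hxD : x ∈ D := ⟨0, Λ.zero_mem, by rw [zero_add]; exact mem_connectedComponentIn hx⟩
    intro hy
    by_contra hyD
    have hyR : y ∈ sublevel K f t \ D :=
      ⟨(mkQ_mem_quotientSublevel_iff hK hf).1 (connectedComponentIn_subset _ _ hy), hyD⟩
    obtain ⟨z, hz, hz1, hz2⟩ := isPreconnected_closed_iff.1
      (isPreconnected_connectedComponentIn (F := quotientSublevel K f Λ t) (x := Λ.mkQ x))
      _ _ (hcl _ hDinv hDclosed) (hcl _ hRinv hRclosed)
      (by
        rw [← Set.image_union, Set.union_sdiff_cancel hDs, image_sublevel]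
        exact connectedComponentIn_subset _ _)
      ⟨_, mem_connectedComponentIn hxq, x, hxD, rfl⟩ ⟨_, hy, y, hyR, rfl⟩
    obtain ⟨w, hw, rfl⟩ := hz1
    have : w ∈ Λ.mkQ ⁻¹' (Λ.mkQ '' (sublevel K f t \ D)) := hz2
    rw [hpre _ hRinv] at this
    exact this.2 hw
  · rintro ⟨u, hu, hy⟩
    have h1 := Λ.isQuotientMap_mkQ.continuous.continuousOn.image_connectedComponentIn_subset hx
      ⟨_, hy, rfl⟩
    rw [image_sublevel] at h1
    rwa [show Λ.mkQ y = Λ.mkQ (u + y) from mkQ_eq_mkQ_iff.2 ⟨u, hu, rfl⟩]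

theorem mkQ_mem_connectedComponentIn (hK : K.IsPeriodic Λ) (hf : K.IsPeriodicFun f Λ)
    {x y : Euc d} (hx : x ∈ sublevel K f t) (hy : y ∈ connectedComponentIn (sublevel K f t) x) :
    Λ.mkQ y ∈ connectedComponentIn (quotientSublevel K f Λ t) (Λ.mkQ x) :=
  (mkQ_mem_connectedComponentIn_iff hK hf hx).2 ⟨0, Λ.zero_mem, by rwa [zero_add]⟩

/-! ### Shadows and periodicity lattices -/

/-- Shadows are simply components of the sublevel set in Euclidean space, since such a component
projects into a single component of the torus. -/
theorem connectedComponentIn_preimage (hK : K.IsPeriodic Λ) (hf : K.IsPeriodicFun f Λ)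
    {x y : Euc d}
    (hy : Λ.mkQ y ∈ connectedComponentIn (quotientSublevel K f Λ t) (Λ.mkQ x)) :
    connectedComponentIn
        (Λ.mkQ ⁻¹' connectedComponentIn (quotientSublevel K f Λ t) (Λ.mkQ x)) y =
      connectedComponentIn (sublevel K f t) y := by
  refine Set.Subset.antisymm (connectedComponentIn_mono _ fun z hz =>
    (mkQ_mem_quotientSublevel_iff hK hf).1 (connectedComponentIn_subset _ _ hz)) ?_
  have hys : y ∈ sublevel K f t :=
    (mkQ_mem_quotientSublevel_iff hK hf).1 (connectedComponentIn_subset _ _ hy)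
  refine isPreconnected_connectedComponentIn.subset_connectedComponentIn
    (mem_connectedComponentIn hys) fun z hz => ?_
  rw [Set.mem_preimage, connectedComponentIn_eq hy]
  exact mkQ_mem_connectedComponentIn hK hf hys hz

theorem mem_periodicityLattice_iff (hK : K.IsPeriodic Λ) (hf : K.IsPeriodicFun f Λ)
    {x u : Euc d} (hx : x ∈ sublevel K f t) :
    u ∈ periodicityLattice Λ (connectedComponentIn (quotientSublevel K f Λ t) (Λ.mkQ x)) ↔
      u ∈ Λ ∧ u + x ∈ connectedComponentIn (sublevel K f t) x := by
  have hxq := mem_connectedComponentIn ((mkQ_mem_quotientSublevel_iff hK hf (t := t)).2 hx)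
  have hstab : u ∈ Λ → (u +ᵥ connectedComponentIn (sublevel K f t) x =
      connectedComponentIn (sublevel K f t) x ↔
        u + x ∈ connectedComponentIn (sublevel K f t) x) := fun hu => by
    rw [vadd_connectedComponentIn hK hf hu hx]
    refine ⟨fun h => ?_, fun h => (connectedComponentIn_eq h).symm⟩
    rw [← h]
    exact mem_connectedComponentIn (add_mem_sublevel hK hf hu hx)
  constructor
  · rintro ⟨hu, h⟩
    refine ⟨hu, (hstab hu).1 (h _ ⟨x, hxq, ?_⟩)⟩
    rw [connectedComponentIn_preimage hK hf hxq]
  · rintro ⟨hu, h⟩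
    refine ⟨hu, ?_⟩
    rintro _ ⟨y, hy, rfl⟩
    rw [connectedComponentIn_preimage hK hf hy]
    obtain ⟨v, hv, hvy⟩ := (mkQ_mem_connectedComponentIn_iff hK hf hx).1 hy
    have hys : y ∈ sublevel K f t :=
      (mkQ_mem_quotientSublevel_iff hK hf).1 (connectedComponentIn_subset _ _ hy)
    have h1 : v +ᵥ connectedComponentIn (sublevel K f t) y =
        connectedComponentIn (sublevel K f t) x := by
      rw [vadd_connectedComponentIn hK hf hv hys, connectedComponentIn_eq hvy]
    -- Any shadow is a translate of the one through `x`, and translations commute, so all shadows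
    -- have the same stabilizer.
    rw [← vadd_left_cancel_iff v, vadd_vadd, add_comm, ← vadd_vadd, h1]
    exact (hstab hu).2 h

/-- Both sides stabilize the same shadow through `x`; the lattice only limits which translations are
admitted. -/
theorem periodicityLattice_eq_inf {Λ' : Submodule ℤ (Euc d)} (hle : Λ' ≤ Λ)
    (hK : K.IsPeriodic Λ) (hf : K.IsPeriodicFun f Λ) {x : Euc d} (hx : x ∈ sublevel K f t) :
    periodicityLattice Λ' (connectedComponentIn (quotientSublevel K f Λ' t) (Λ'.mkQ x)) =
      Λ' ⊓ periodicityLattice Λ (connectedComponentIn (quotientSublevel K f Λ t) (Λ.mkQ x)) := by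
  ext u
  rw [mem_periodicityLattice_iff (hK.mono hle) (hf.mono hle) hx, Submodule.mem_inf,
    mem_periodicityLattice_iff hK hf hx]
  exact ⟨fun h => ⟨h.1, hle h.1, h.2⟩, fun h => ⟨h.1, h.2.2⟩⟩

/-! ### Finiteness -/

/-- Up to translation by the lattice there are only finitely many cells. -/
theorem exists_finite_cells [DiscreteTopology Λ] [IsZLattice ℝ Λ] (hK : K.IsPeriodic Λ) :
    ∃ F : Set K.cells, F.Finite ∧
      ∀ σ : K.cells, ∃ τ ∈ F, ∃ u ∈ Λ, (τ : Set (Euc d)) = u +ᵥ (σ : Set (Euc d)) := by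
  have b := (Module.Free.chooseBasis ℤ Λ)
  let b' := b.ofZLatticeBasis ℝ Λ
  have hb : Submodule.span ℤ (Set.range b') = Λ := b.ofZLatticeBasis_span ℝ
  have hc := (ZSpan.fundamentalDomain_isBounded b').isCompact_closure
  -- The representatives are the cells that meet the compact closure of a fundamental domain.
  refine ⟨_, K.locallyFinite.finite_nonempty_inter_compact hc, fun σ => ?_⟩
  obtain ⟨x, hx⟩ := (K.isConnected_cell σ).nonempty
  obtain ⟨v, hv, -⟩ := ZSpan.exist_unique_vadd_mem_fundamentalDomain b' x
  have hvΛ : (v : Euc d) ∈ Λ := hb.le v.2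
  exact ⟨⟨_, hK σ σ.2 v hvΛ⟩, ⟨(v : Euc d) + x, Set.vadd_mem_vadd_set hx, subset_closure hv⟩,
    v, hvΛ, rfl⟩

theorem exists_point (hK : K.IsPeriodic Λ) (hf : K.IsPeriodicFun f Λ)
    (A : PeriodicMergeTree K f Λ) : ∃ x, x ∈ sublevel K f A.height ∧ Λ.mkQ x ∈ A.comp := by
  obtain ⟨y, hy⟩ := A.comp_nonempty
  obtain ⟨x, rfl⟩ := Λ.mkQ_surjective y
  exact ⟨x, (mkQ_mem_quotientSublevel_iff hK hf).1 (A.comp_subset hy), hy⟩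

theorem quotientSublevel_mono : Monotone (quotientSublevel K f Λ) := fun s t hst => by
  rw [← image_sublevel, ← image_sublevel]
  refine Set.image_mono fun x hx => ?_
  obtain ⟨σ, hσ, h⟩ := mem_sublevel.1 hx
  exact mem_sublevel.2 ⟨σ, hσ.trans hst, h⟩

theorem isTame_quotientSublevel [DiscreteTopology Λ] [IsZLattice ℝ Λ] (hK : K.IsPeriodic Λ)
    (hf : K.IsPeriodicFun f Λ) : IsTame (quotientSublevel K f Λ) (Set.range f) := by
  obtain ⟨F, hF, hcell⟩ := exists_finite_cells hK
  refine ⟨quotientSublevel_mono, ?_, ?_, ?_, ?_⟩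
  · refine (hF.image f).subset ?_
    rintro _ ⟨σ, rfl⟩
    obtain ⟨τ, hτ, u, hu, h⟩ := hcell σ
    exact ⟨τ, hτ, hf σ τ u hu h⟩
  · intro s t hst hd
    refine Set.Subset.antisymm (quotientSublevel_mono hst) ?_
    rw [← image_sublevel, ← image_sublevel]
    refine Set.image_mono fun x hx => ?_
    obtain ⟨σ, hσ, h⟩ := mem_sublevel.1 hx
    exact mem_sublevel.2 ⟨σ, not_lt.1 fun hlt => Set.disjoint_left.1 hd ⟨σ, rfl⟩ ⟨hlt, hσ⟩, h⟩
  · intro t x hx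
    rw [← image_sublevel] at hx
    obtain ⟨y, hy, -⟩ := hx
    obtain ⟨σ, hσ, -⟩ := mem_sublevel.1 hy
    exact ⟨_, ⟨σ, rfl⟩, hσ⟩
  · intro t
    -- Every component at height `t` contains the sample point of some representative cell.
    -- Representatives above level `t` may add superfluous sets, which does no harm.
    choose p hp using fun σ : K.cells => (K.isConnected_cell σ).nonempty
    refine Set.Finite.of_finite_image ((hF.image fun σ =>
      connectedComponentIn (quotientSublevel K f Λ t) (Λ.mkQ (p σ))).subset ?_)
      (f := MergeTree.comp) fun A hA B hB h => eq_of_height_eq_of_comp_eq (hA.trans hB.symm) h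
    rintro _ ⟨A, hA, rfl⟩
    obtain ⟨x, hx, hxA⟩ := exists_point hK hf A
    obtain rfl : A.height = t := hA
    obtain ⟨σ, hσ, hxσ⟩ := mem_sublevel.1 hx
    obtain ⟨τ, hτ, u, hu, h⟩ := hcell σ
    refine ⟨τ, hτ, ?_⟩
    have hux : u + x ∈ (τ : Set (Euc d)) := h ▸ Set.vadd_mem_vadd_set hxσ
    have h1 := cell_subset_connectedComponentIn ((hf σ τ u hu h).trans_le hσ) hux (hp τ)
    have h2 := mkQ_mem_connectedComponentIn hK hf (add_mem_sublevel hK hf hu hx) h1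
    rw [comp_eq_of_mem hxA, show Λ.mkQ x = Λ.mkQ (u + x) from mkQ_eq_mkQ_iff.2 ⟨u, hu, rfl⟩]
    exact (connectedComponentIn_eq h2).symm

/-! ### Passing to a sublattice -/

/-- Expresses the birth upstairs in ℝ^d: apart from the height of `A`, the right-hand side does not
see the lattice. -/
theorem birth_eq (hK : K.IsPeriodic Λ) (hf : K.IsPeriodicFun f Λ) {A : PeriodicMergeTree K f Λ}
    {x : Euc d} (hx : Λ.mkQ x ∈ A.comp) :
    A.birth = sInf {s | s ≤ A.height ∧ ∃ z ∈ sublevel K f s,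
      z ∈ connectedComponentIn (sublevel K f A.height) x} := by
  have hxs := (mkQ_mem_quotientSublevel_iff hK hf).1 (A.comp_subset hx)
  rw [birth]
  congr 1
  ext s
  constructor
  · rintro ⟨B, hB, rfl⟩
    obtain ⟨y, hy, hyB⟩ := exists_point hK hf B
    have hyA := hB.2 hyB
    rw [comp_eq_of_mem hx, mkQ_mem_connectedComponentIn_iff hK hf hxs] at hyA
    obtain ⟨u, hu, h⟩ := hyA
    exact ⟨hB.1, u + y, add_mem_sublevel hK hf hu hy, h⟩
  · rintro ⟨hs, z, hz, hzx⟩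
    have hzq := (mkQ_mem_quotientSublevel_iff hK hf).2 hz
    refine ⟨MergeTree.mk (Λ.mkQ z) s hzq, le_of_mem_comp quotientSublevel_mono
      (mem_connectedComponentIn hzq) ?_ hs, rfl⟩
    rw [comp_eq_of_mem hx]
    exact mkQ_mem_connectedComponentIn hK hf hxs hzx

/-- The points of the periodic merge tree for a sublattice that project to a given point. -/
def fiberOver (Λ' : Submodule ℤ (Euc d)) (A : PeriodicMergeTree K f Λ) :
    Set (PeriodicMergeTree K f Λ') :=
  {A' | A'.height = A.height ∧ ∃ x, Λ.mkQ x ∈ A.comp ∧ Λ'.mkQ x ∈ A'.comp}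

variable {Λ' : Submodule ℤ (Euc d)}

theorem mkQ_mem_comp_of_mem_fiberOver (hle : Λ' ≤ Λ) (hK : K.IsPeriodic Λ)
    (hf : K.IsPeriodicFun f Λ) {A : PeriodicMergeTree K f Λ} {A' : PeriodicMergeTree K f Λ'}
    (h : A' ∈ fiberOver Λ' A) {y : Euc d} (hy : Λ'.mkQ y ∈ A'.comp) : Λ.mkQ y ∈ A.comp := by
  obtain ⟨hh, x, hxA, hxA'⟩ := h
  have hxs := (mkQ_mem_quotientSublevel_iff hK hf).1 (A.comp_subset hxA)
  rw [comp_eq_of_mem hxA', hh,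
    mkQ_mem_connectedComponentIn_iff (hK.mono hle) (hf.mono hle) hxs] at hy
  obtain ⟨u, hu, hy⟩ := hy
  rw [comp_eq_of_mem hxA, mkQ_mem_connectedComponentIn_iff hK hf hxs]
  exact ⟨u, hle hu, hy⟩

theorem iUnion_fiberOver (hle : Λ' ≤ Λ) (hK : K.IsPeriodic Λ) (hf : K.IsPeriodicFun f Λ) :
    ⋃ A ∈ {A : PeriodicMergeTree K f Λ | A.height = t}, fiberOver Λ' A =
      {A' : PeriodicMergeTree K f Λ' | A'.height = t} := by
  ext A'
  constructor
  · intro h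
    obtain ⟨A, hA, h⟩ := Set.mem_iUnion₂.1 h
    exact h.1.trans hA
  · rintro rfl
    obtain ⟨x, hx, hxA⟩ := exists_point (hK.mono hle) (hf.mono hle) A'
    have hxq := (mkQ_mem_quotientSublevel_iff hK hf).2 hx
    exact Set.mem_iUnion₂.2 ⟨MergeTree.mk (Λ.mkQ x) A'.height hxq, rfl, rfl, x,
      mem_connectedComponentIn hxq, hxA⟩

theorem pairwiseDisjoint_fiberOver (hle : Λ' ≤ Λ) (hK : K.IsPeriodic Λ)
    (hf : K.IsPeriodicFun f Λ) :
    {A : PeriodicMergeTree K f Λ | A.height = t}.PairwiseDisjoint (fiberOver Λ') := by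
  intro A hA B hB hne
  refine Set.disjoint_left.2 fun A' h1 h2 => hne ?_
  obtain ⟨-, x, hx, hx'⟩ := id h1
  have hxB := mkQ_mem_comp_of_mem_fiberOver hle hK hf h2 hx'
  refine eq_of_height_eq_of_comp_eq (hA.trans hB.symm) ?_
  rw [comp_eq_of_mem hx, comp_eq_of_mem hxB, hA, hB]

/-- Orbit counting: `F` induces a bijection from the left cosets of `H` onto its range. -/
theorem Nat.card_range_eq_index {G α : Type*} [AddGroup G] (H : AddSubgroup G) (F : G → α)
    (hF : ∀ u v, F u = F v ↔ -u + v ∈ H) : Nat.card (Set.range F) = H.index := by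
  refine (Nat.card_eq_of_bijective (Quotient.lift (fun u => (⟨F u, u, rfl⟩ : Set.range F))
    fun u v huv => Subtype.ext ((hF u v).2 (QuotientAddGroup.leftRel_apply.1 huv))) ⟨?_, ?_⟩).symm
  · intro a b
    induction a using Quotient.inductionOn
    induction b using Quotient.inductionOn
    intro h
    exact Quotient.sound (QuotientAddGroup.leftRel_apply.2 ((hF _ _).1 (congrArg Subtype.val h)))
  · rintro ⟨_, u, rfl⟩
    exact ⟨Quotient.mk _ u, rfl⟩

/-- Translates of one point `x` by Λ reach every component in the fiber, and two translates lie in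
the same component over Λ' exactly when they differ by an element of Λ' + S, where S is the
periodicity lattice of `A`. -/
theorem card_fiberOver (hle : Λ' ≤ Λ) (hK : K.IsPeriodic Λ) (hf : K.IsPeriodicFun f Λ)
    (A : PeriodicMergeTree K f Λ) :
    (fiberOver Λ' A).ncard =
      (Λ' ⊔ periodicityLattice Λ A.comp).toAddSubgroup.relIndex Λ.toAddSubgroup := by
  obtain ⟨x, hx, hxA⟩ := exists_point hK hf A
  have hK' := hK.mono hle
  have hf' := hf.mono hle
  have hmem : ∀ u : Λ.toAddSubgroup, (u : Euc d) + x ∈ sublevel K f A.height :=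
    fun u => add_mem_sublevel hK hf u.2 hx
  have hq : ∀ u : Λ.toAddSubgroup, Λ'.mkQ (u + x) ∈ quotientSublevel K f Λ' A.height :=
    fun u => (mkQ_mem_quotientSublevel_iff hK' hf').2 (hmem u)
  let F : Λ.toAddSubgroup → PeriodicMergeTree K f Λ' := fun u => MergeTree.mk _ A.height (hq u)
  have hrange : fiberOver Λ' A = Set.range F := by
    ext A'
    constructor
    · rintro ⟨hh, y, hyA, hyA'⟩
      have hys := (mkQ_mem_quotientSublevel_iff hK hf).1 (A.comp_subset hyA)
      rw [comp_eq_of_mem hxA, mkQ_mem_connectedComponentIn_iff hK hf hx] at hyA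
      obtain ⟨u, hu, huy⟩ := hyA
      -- Since `u + y` is in the component of `x`, the point `y` is in that of `-u + x`.
      refine ⟨-⟨u, hu⟩, eq_of_height_eq_of_comp_eq hh.symm ?_⟩
      rw [comp_eq_of_mem hyA', hh]
      refine connectedComponentIn_eq (mkQ_mem_connectedComponentIn hK' hf' (hmem _) ?_)
      rw [← add_mem_connectedComponentIn_iff hK hf hu (hmem _)]
      simpa using huy
    · rintro ⟨u, rfl⟩
      refine ⟨rfl, u + x, ?_, mem_connectedComponentIn (hq u)⟩
      rwa [← show Λ.mkQ x = Λ.mkQ (u + x) from mkQ_eq_mkQ_iff.2 ⟨u, u.2, rfl⟩]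
  rw [hrange, ← Nat.card_coe_set_eq]
  refine Nat.card_range_eq_index _ F fun u v => ?_
  rw [AddSubgroup.mem_addSubgroupOf]
  have h1 : F u = F v ↔ Λ'.mkQ (v + x) ∈
      connectedComponentIn (quotientSublevel K f Λ' A.height) (Λ'.mkQ (u + x)) := by
    refine ⟨fun h => ?_, fun h => eq_of_height_eq_of_comp_eq rfl (connectedComponentIn_eq h)⟩
    have h2 : connectedComponentIn (quotientSublevel K f Λ' A.height) (Λ'.mkQ (u + x)) =
      connectedComponentIn (quotientSublevel K f Λ' A.height) (Λ'.mkQ (v + x)) :=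
        congrArg MergeTree.comp h
    rw [h2]
    exact mem_connectedComponentIn (hq v)
  rw [h1, mkQ_mem_connectedComponentIn_iff hK' hf' (hmem u)]
  have h3 : ∀ w ∈ Λ, (w + (v + x) ∈ connectedComponentIn (sublevel K f A.height) (u + x) ↔
      w + (-u + v) ∈ periodicityLattice Λ A.comp) := fun w hw => by
    rw [comp_eq_of_mem hxA, mem_periodicityLattice_iff hK hf hx,
      ← add_mem_connectedComponentIn_iff hK hf u.2 hx]
    have h4 : (u : Euc d) + (w + (-u + v) + x) = w + (v + x) := by abel
    rw [h4, and_iff_right]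
    exact Λ.add_mem hw (Λ.add_mem (Λ.neg_mem u.2) v.2)
  change _ ↔ (-u + v : Euc d) ∈ Λ' ⊔ periodicityLattice Λ A.comp
  rw [Submodule.mem_sup]
  constructor
  · rintro ⟨w, hw, h⟩
    exact ⟨-w, Λ'.neg_mem hw, _, (h3 w (hle hw)).1 h, by abel⟩
  · rintro ⟨w, hw, s, hs, h⟩
    refine ⟨-w, Λ'.neg_mem hw, (h3 _ (Λ.neg_mem (hle hw))).2 ?_⟩
    rwa [← h, neg_add_cancel_left]

/-- The sum over Λ' is grouped by fibers. All points of a fiber have the exponent and birth of the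
point below and equal multiplicities, so each fiber contributes its cardinality times one density.
-/
theorem eraDensity_eq_of_le [DiscreteTopology Λ] [IsZLattice ℝ Λ] [DiscreteTopology Λ']
    [IsZLattice ℝ Λ'] (hle : Λ' ≤ Λ) (hK : K.IsPeriodic Λ) (hf : K.IsPeriodicFun f Λ)
    (q : ℕ) (b t : ℝ) :
    eraDensity (frequency K f Λ') q b t = eraDensity (frequency K f Λ) q b t := by
  classical
  have hK' := hK.mono hle
  have hf' := hf.mono hle
  have htame := isTame_quotientSublevel hK hf
  have htame' := isTame_quotientSublevel hK' hf'
  rw [eraDensity, eraDensity, ← iUnion_fiberOver hle hK hf,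
    finsum_mem_biUnion (pairwiseDisjoint_fiberOver hle hK hf) (htame.finite_height t)
      fun A _ => (htame'.finite_height A.height).subset fun A' hA' => hA'.1]
  refine finsum_mem_congr rfl fun A hA => ?_
  have hS : periodicityLattice Λ A.comp ≤ Λ := fun _ h => h.1
  have hconst : ∀ A' ∈ fiberOver Λ' A, periodicityLattice Λ' A'.comp =
      Λ' ⊓ periodicityLattice Λ A.comp ∧ A'.birth = A.birth := by
    rintro A' ⟨hh, x, hxA, hxA'⟩
    have hxs := (mkQ_mem_quotientSublevel_iff hK hf).1 (A.comp_subset hxA)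
    refine ⟨?_, ?_⟩
    · rw [comp_eq_of_mem hxA, comp_eq_of_mem hxA', hh, periodicityLattice_eq_inf hle hK hf hxs]
    · rw [birth_eq hK hf hxA, birth_eq hK' hf' hxA', hh]
  have hterm : ∀ A' ∈ fiberOver Λ' A,
      (if (frequency K f Λ' A').natDegree = q ∧ A'.birth = b then
        (frequency K f Λ' A').leadingCoeff / unitBallVolume (frequency K f Λ' A').natDegree
        else 0) =
      if (frequency K f Λ A).natDegree = q ∧ A.birth = b then
        latticeVolume (Λ' ⊓ periodicityLattice Λ A.comp) / latticeVolume Λ' else 0 := by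
    intro A' hA'
    obtain ⟨h1, h2⟩ := hconst A' hA'
    rw [frequency, frequency, leadingCoeff_shadowMonomial_div, natDegree_shadowMonomial,
      natDegree_shadowMonomial, h1, h2, latticeDim_inf_eq hle hS]
  have hfin : (fiberOver Λ' A).Finite :=
    (htame'.finite_height A.height).subset fun A' hA' => hA'.1
  rw [finsum_mem_congr rfl hterm, finsum_mem_eq_finite_toFinset_sum _ hfin, Finset.sum_const,
    ← Set.ncard_eq_toFinset_card _ hfin, card_fiberOver hle hK hf, nsmul_eq_mul, mul_ite, mul_zero,
    relIndex_sup_mul_latticeVolume_div hle hS, frequency, leadingCoeff_shadowMonomial_div]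

end Sublevel

theorem mainTheorem5 {d : ℕ} (Λ Λ' Λ'' : Submodule ℤ (Euc d))
    [DiscreteTopology Λ] [IsZLattice ℝ Λ]
    [DiscreteTopology Λ'] [IsZLattice ℝ Λ']
    [DiscreteTopology Λ''] [IsZLattice ℝ Λ'']
    (hΛ' : Λ' ≤ Λ) (hΛ'' : Λ'' ≤ Λ)
    (K : CellComplex d) (hK : K.IsPeriodic Λ)
    (f : K.cells → ℝ) (hf : K.IsFilter f) (hfΛ : K.IsPeriodicFun f Λ) :
    Nonempty (PeriodicElderRule K f Λ') ∧ Nonempty (PeriodicElderRule K f Λ'') ∧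
      ∀ (e' : PeriodicElderRule K f Λ') (e'' : PeriodicElderRule K f Λ''),
        Finite (Epoch e' (frequency K f Λ')) ∧ Finite (Epoch e'' (frequency K f Λ'')) ∧
          periodicBarcode K f Λ' e' = periodicBarcode K f Λ'' e'' := by
  have hK' := hK.mono hΛ'
  have hK'' := hK.mono hΛ''
  have hf' := hfΛ.mono hΛ'
  have hf'' := hfΛ.mono hΛ''
  have h' := isTame_quotientSublevel hK' hf'
  have h'' := isTame_quotientSublevel hK'' hf''
  refine ⟨h'.nonempty_elderRule, h''.nonempty_elderRule, fun e' e'' =>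
    ⟨finite_epoch h' e' (shadowMonomial Λ'), finite_epoch h'' e'' (shadowMonomial Λ''),
      barcode_eq_of_eraDensity_eq h' h'' e' e'' (shadowMonomial Λ') (shadowMonomial Λ'')
        fun q b t => ?_⟩⟩
  -- Neither sublattice need contain the other; Λ mediates.
  exact (eraDensity_eq_of_le hΛ' hK hfΛ q b t).trans (eraDensity_eq_of_le hΛ'' hK hfΛ q b t).symm
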